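/- Let $\Omega\subset\mathbb{R}^N$ be a bounded domain of class $C^{2+\alpha}$ for some $\alpha>0$, let $q>p-1>1$, let $g\in C^2(\overline\Omega)$ with $g\ge 0$ on $\partial\Omega$, and let $u_0\in W^{1,\infty}(\Omega)\cap C(\overline\Omega)$ satisfy $u_0\ge 0$ in $\Omega$ and $u_0=g$ on $\partial\Omega$. Consider $$\partial_t u-\mathrm{div}(|\nabla u|^{p-2}\nabla u)=|\nabla u|^q\ \text{ in }\Omega\times(0,T),\qquad u=g\ \text{ on }\partial\Omega\times(0,T),\qquad u(\cdot,0)=u_0\ \text{ in }\Omega .\tag{P}$$ Put $Q_\tau=\Omega\times(0,\tau)$ and $m=\max(p,q)$. A weak supersolution (subsolution) of (P) on $Q_\tau$ is a function $u\in C(\overline\Omega\times[0,\tau))\cap L^m((0,\tau);W^{1,m}(\Omega))$ with $u_t\in L^2((0,\tau);L^2(\Omega))$, $u(\cdot,0)\ge(\le)\,u_0$ in $\Omega$, $u\ge(\le)\,g$ on $\partial\Omega\times(0,\tau)$, and $$\iint_{Q_\tau}\big(u_t\psi+|\nabla u|^{p-2}\nabla u\cdot\nabla\psi\big)\,dx\,dt\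 \ge(\le)\ \iint_{Q_\tau}|\nabla u|^q\psi\,dx\,dt$$ for all $\psi\in C(\overline{Q_\tau})\cap L^p((0,\tau);W^{1,p}(\Omega))$ with $\psi\ge0$ and $\psi=0$ on $\partial\Omega\times(0,\tau)$. A weak solution is a function that is both a weak super- and a weak subsolution. Theorem. Let $T\in(0,\infty]$ and let $u$ be a weak solution of (P) on $Q_\tau$ for every $\tau\in(0,T)$, with $u\in L^\infty_{loc}([0,T);W^{1,\infty}(\Omega))$ (in particular, $u$ may be the unique maximal weak solution in this class, with $T=T_{max}(u_0)$ its maximal existence time). Then $$u_t(\cdot,t)\le\frac{1}{p-2}\,\frac{\|u_0\|_{L^\infty(\Omega)}}{t}\quad\text{in }\mathcal D'(\Omega)\text{ for a.e. }t\in(0,T),$$ and consequently $$\Delta_p u(\cdot,t)=\mathrm{div}\big(|\nabla u|^{p-2}\nabla u\big)(\cdot,t)\le\frac{1}{p-2}\,\frac{\|u_0\|_{L^\infty(\Omega)}}{t}\quad\text{in }\mathcal D'(\Omega)\text{ for a.e. }t\in(0,T).$$ -/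

import Mathlib

open MeasureTheory Set
open scoped ENNReal NNReal ContDiff

namespace DegenerateHJ

/-- `φ` is a test function on the open set `U`: smooth with compact support inside `U`. -/
def IsTestFunction {X : Type*} [NormedAddCommGroup X] [NormedSpace ℝ X]
    (U : Set X) (φ : X → ℝ) : Prop :=
  ContDiff ℝ ∞ φ ∧ HasCompactSupport φ ∧ tsupport φ ⊆ U

/-- `Ω` has a boundary of class `C^{2+α}` for some `α ∈ (0,1]`: near each boundary point `Ω` is the
negativity set of a `C^2` function with `α`-Hölder second derivatives and non-vanishing
differential at that point. -/
def HasC2HolderBoundary {N : ℕ} (Ω : Set (EuclideanSpace ℝ (Fin N))) : Prop :=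
  ∃ α : ℝ≥0, 0 < α ∧ α ≤ 1 ∧ ∀ x₀ ∈ frontier Ω,
    ∃ (U : Set (EuclideanSpace ℝ (Fin N))) (ρ : EuclideanSpace ℝ (Fin N) → ℝ),
      IsOpen U ∧ x₀ ∈ U ∧ ContDiffOn ℝ 2 ρ U ∧
      (∃ C : ℝ≥0, HolderOnWith C α (iteratedFDeriv ℝ 2 ρ) U) ∧
      fderiv ℝ ρ x₀ ≠ 0 ∧ Ω ∩ U = {x ∈ U | ρ x < 0}

/-- `G` is the weak gradient of `f` on the open set `Ω`. -/
def IsWeakGradient {N : ℕ} (Ω : Set (EuclideanSpace ℝ (Fin N)))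
    (f : EuclideanSpace ℝ (Fin N) → ℝ)
    (G : EuclideanSpace ℝ (Fin N) → EuclideanSpace ℝ (Fin N)) : Prop :=
  LocallyIntegrableOn f Ω ∧ LocallyIntegrableOn G Ω ∧
    ∀ φ : EuclideanSpace ℝ (Fin N) → ℝ, IsTestFunction Ω φ →
      ∀ v : EuclideanSpace ℝ (Fin N),
        ∫ x in Ω, f x * fderiv ℝ φ x v = -∫ x in Ω, inner ℝ (G x) v * φ x

/-- `f ∈ W^{1,r}(Ω)`. -/
def MemW1 {N : ℕ} (Ω : Set (EuclideanSpace ℝ (Fin N))) (r : ℝ≥0∞)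
    (f : EuclideanSpace ℝ (Fin N) → ℝ) : Prop :=
  ∃ G : EuclideanSpace ℝ (Fin N) → EuclideanSpace ℝ (Fin N),
    IsWeakGradient Ω f G ∧ MemLp f r (volume.restrict Ω) ∧ MemLp G r (volume.restrict Ω)

/-- The cylinder `Q_T = Ω × (0,T)`. -/
def cylinder {N : ℕ} (Ω : Set (EuclideanSpace ℝ (Fin N))) (T : ℝ) :
    Set (EuclideanSpace ℝ (Fin N) × ℝ) :=
  Ω ×ˢ Ioo 0 T

/-- `u ∈ L^r((0,T); W^{1,r}(Ω))`, and the field `Du` is its weak gradient in the space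
variable. -/
def MemLpW1 {N : ℕ} (Ω : Set (EuclideanSpace ℝ (Fin N))) (T : ℝ) (r : ℝ≥0∞)
    (u : EuclideanSpace ℝ (Fin N) × ℝ → ℝ)
    (Du : EuclideanSpace ℝ (Fin N) × ℝ → EuclideanSpace ℝ (Fin N)) : Prop :=
  MemLp u r (volume.restrict (cylinder Ω T)) ∧
  MemLp Du r (volume.restrict (cylinder Ω T)) ∧
  ∀ᵐ t ∂(volume.restrict (Ioo 0 T)),
    IsWeakGradient Ω (fun x => u (x, t)) (fun x => Du (x, t))

/-- `ut` is the weak time derivative of `u` on `Q_T`, and `ut ∈ L^2((0,T); L^2(Ω))`. -/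
def HasL2TimeDeriv {N : ℕ} (Ω : Set (EuclideanSpace ℝ (Fin N))) (T : ℝ)
    (u ut : EuclideanSpace ℝ (Fin N) × ℝ → ℝ) : Prop :=
  MemLp ut 2 (volume.restrict (cylinder Ω T)) ∧
  ∀ φ : EuclideanSpace ℝ (Fin N) × ℝ → ℝ, IsTestFunction (cylinder Ω T) φ →
    ∫ z in cylinder Ω T, u z * fderiv ℝ φ z (0, 1) = -∫ z in cylinder Ω T, ut z * φ z

/-- The regularity required of weak sub- and supersolutions on `Q_T`, with `m = max p q`;
`Du` and `ut` are the weak spatial gradient and the weak time derivative of `u`. -/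
def WeakRegularity {N : ℕ} (Ω : Set (EuclideanSpace ℝ (Fin N))) (p q T : ℝ)
    (u : EuclideanSpace ℝ (Fin N) × ℝ → ℝ)
    (Du : EuclideanSpace ℝ (Fin N) × ℝ → EuclideanSpace ℝ (Fin N))
    (ut : EuclideanSpace ℝ (Fin N) × ℝ → ℝ) : Prop :=
  ContinuousOn u (closure Ω ×ˢ Ico 0 T) ∧
  MemLpW1 Ω T (ENNReal.ofReal (max p q)) u Du ∧
  HasL2TimeDeriv Ω T u ut

/-- Admissible test functions `ψ` (with spatial gradient `Dψ`) in the weak formulation on `Q_T`: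
`ψ ∈ C(closure Q_T) ∩ L^p((0,T); W^{1,p}(Ω))`, `ψ ≥ 0`, and `ψ = 0` on `∂Ω × (0,T)`. -/
def IsAdmissible {N : ℕ} (Ω : Set (EuclideanSpace ℝ (Fin N))) (p T : ℝ)
    (ψ : EuclideanSpace ℝ (Fin N) × ℝ → ℝ)
    (Dψ : EuclideanSpace ℝ (Fin N) × ℝ → EuclideanSpace ℝ (Fin N)) : Prop :=
  ContinuousOn ψ (closure (cylinder Ω T)) ∧
  MemLpW1 Ω T (ENNReal.ofReal p) ψ Dψ ∧
  (∀ z ∈ cylinder Ω T, 0 ≤ ψ z) ∧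
  ∀ x ∈ frontier Ω, ∀ t ∈ Ioo 0 T, ψ (x, t) = 0

/-- Weak supersolution on `Q_T` of `u_t - div(|∇u|^{p-2}∇u) = |∇u|^q`, `u = g` on `∂Ω`,
`u(·,0) = u₀`. -/
def IsWeakSupersolution {N : ℕ} (Ω : Set (EuclideanSpace ℝ (Fin N))) (p q : ℝ)
    (g u₀ : EuclideanSpace ℝ (Fin N) → ℝ) (T : ℝ)
    (u : EuclideanSpace ℝ (Fin N) × ℝ → ℝ)
    (Du : EuclideanSpace ℝ (Fin N) × ℝ → EuclideanSpace ℝ (Fin N))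
    (ut : EuclideanSpace ℝ (Fin N) × ℝ → ℝ) : Prop :=
  WeakRegularity Ω p q T u Du ut ∧
  (∀ x ∈ Ω, u₀ x ≤ u (x, 0)) ∧
  (∀ x ∈ frontier Ω, ∀ t ∈ Ioo 0 T, g x ≤ u (x, t)) ∧
  ∀ (ψ : EuclideanSpace ℝ (Fin N) × ℝ → ℝ)
    (Dψ : EuclideanSpace ℝ (Fin N) × ℝ → EuclideanSpace ℝ (Fin N)),
    IsAdmissible Ω p T ψ Dψ →
      ∫ z in cylinder Ω T, ‖Du z‖ ^ q * ψ z ≤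
        ∫ z in cylinder Ω T, (ut z * ψ z + ‖Du z‖ ^ (p - 2) * inner ℝ (Du z) (Dψ z))

/-- Weak subsolution on `Q_T` of `u_t - div(|∇u|^{p-2}∇u) = |∇u|^q`, `u = g` on `∂Ω`,
`u(·,0) = u₀`. -/
def IsWeakSubsolution {N : ℕ} (Ω : Set (EuclideanSpace ℝ (Fin N))) (p q : ℝ)
    (g u₀ : EuclideanSpace ℝ (Fin N) → ℝ) (T : ℝ)
    (u : EuclideanSpace ℝ (Fin N) × ℝ → ℝ)
    (Du : EuclideanSpace ℝ (Fin N) × ℝ → EuclideanSpace ℝ (Fin N))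
    (ut : EuclideanSpace ℝ (Fin N) × ℝ → ℝ) : Prop :=
  WeakRegularity Ω p q T u Du ut ∧
  (∀ x ∈ Ω, u (x, 0) ≤ u₀ x) ∧
  (∀ x ∈ frontier Ω, ∀ t ∈ Ioo 0 T, u (x, t) ≤ g x) ∧
  ∀ (ψ : EuclideanSpace ℝ (Fin N) × ℝ → ℝ)
    (Dψ : EuclideanSpace ℝ (Fin N) × ℝ → EuclideanSpace ℝ (Fin N)),
    IsAdmissible Ω p T ψ Dψ →
      ∫ z in cylinder Ω T, (ut z * ψ z + ‖Du z‖ ^ (p - 2) * inner ℝ (Du z) (Dψ z)) ≤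
        ∫ z in cylinder Ω T, ‖Du z‖ ^ q * ψ z

/-- Weak solution on `Q_T`, with weak spatial gradient `Du` and weak time derivative `ut`. -/
def IsWeakSolution {N : ℕ} (Ω : Set (EuclideanSpace ℝ (Fin N))) (p q : ℝ)
    (g u₀ : EuclideanSpace ℝ (Fin N) → ℝ) (T : ℝ)
    (u : EuclideanSpace ℝ (Fin N) × ℝ → ℝ)
    (Du : EuclideanSpace ℝ (Fin N) × ℝ → EuclideanSpace ℝ (Fin N))
    (ut : EuclideanSpace ℝ (Fin N) × ℝ → ℝ) : Prop :=
  IsWeakSupersolution Ω p q g u₀ T u Du ut ∧ IsWeakSubsolution Ω p q g u₀ T u Du ut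

/-- `f ≤ c` in `D'(Ω)` for a function `f ∈ L^1_loc(Ω)` and a constant `c`. -/
def DistribLE {N : ℕ} (Ω : Set (EuclideanSpace ℝ (Fin N)))
    (f : EuclideanSpace ℝ (Fin N) → ℝ) (c : ℝ) : Prop :=
  LocallyIntegrableOn f Ω ∧
  ∀ φ : EuclideanSpace ℝ (Fin N) → ℝ, IsTestFunction Ω φ → (∀ x, 0 ≤ φ x) →
    ∫ x in Ω, f x * φ x ≤ ∫ x in Ω, c * φ x

/-- `div F ≤ c` in `D'(Ω)` for a vector field `F ∈ L^1_loc(Ω)` and a constant `c`, the divergence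
being the distribution `φ ↦ -∫ F · ∇φ`. -/
def DistribDivLE {N : ℕ} (Ω : Set (EuclideanSpace ℝ (Fin N)))
    (F : EuclideanSpace ℝ (Fin N) → EuclideanSpace ℝ (Fin N)) (c : ℝ) : Prop :=
  LocallyIntegrableOn F Ω ∧
  ∀ φ : EuclideanSpace ℝ (Fin N) → ℝ, IsTestFunction Ω φ → (∀ x, 0 ≤ φ x) →
    -∫ x in Ω, fderiv ℝ φ x (F x) ≤ ∫ x in Ω, c * φ x

/-- The norm of `f` in `L^∞(Ω)`. -/
noncomputable def supNorm {N : ℕ} (Ω : Set (EuclideanSpace ℝ (Fin N)))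
    (f : EuclideanSpace ℝ (Fin N) → ℝ) : ℝ :=
  (eLpNorm f ∞ (volume.restrict Ω)).toReal

end DegenerateHJ

/-!
# A one-sided bound on the time derivative for a degenerate Hamilton-Jacobi equation

The equation `u_t - div (|∇u|^(p-2) ∇u) = |∇u|^q` is almost homogeneous. For `l ≥ 1` the function
`l u(x, l^(p-2) t)` satisfies the same equation with the source multiplied by `l^(p-1-q) ≤ 1`, so
it is a subsolution; after subtraction of `(l - 1) ‖u₀‖_∞` it lies below `u` on the parabolic
boundary, because `u₀ ≤ ‖u₀‖_∞` and `g = u₀` on `∂Ω` (`IsWeakSubsolution.rescale`). By comparison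
it lies below `u` everywhere, and since `u ≥ 0`,
`u(x, κ t) - u(x, t) ≤ (κ^(1/(p-2)) - 1) ‖u₀‖_∞` for `κ = l^(p-2) ≥ 1`
(`growth_of_isWeakSolution`). Mollification turns this into the pointwise bound
`u_t ≤ ‖u₀‖_∞ / ((p-2) t)` almost everywhere (`ae_time_deriv_le`). The bound on the divergence
follows from the equation since `|∇u|^q ≥ 0` (`ae_neg_integral_flux_le`); that the exceptional null
set of times can be chosen independently of the test function is a matter of separability
(`exists_countable_testFunctions`).

The comparison principle (`comparison_principle`) is an energy estimate. Let `w` be the difference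
of a sub- and a supersolution, and test with `(w⁺)²`. The source contributes at most
`q μ^(q-1) |∇w| (w⁺)²`, where `μ` bounds the gradients pointwise, while the diffusion contributes at
least `μ^(p-2) |∇w|² w⁺`; as `q ≥ p/2` and the gradients are bounded, Young's inequality leaves a
multiple of `∫ (w⁺)³`, and Grönwall's lemma applies (`source_sub_diffusion_le`,
`integral_cube_posPart_le`). The test function and the energy are handled by a chain rule for weak
directional derivatives of continuous functions (`HasWeakDeriv.comp`), used on time slices for the
gradient and on the cylinder for the time derivative, and by the fundamental theorem of calculus in
time (`integral_weak_time_deriv`).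
-/

namespace DegenerateHJ

open Filter Topology Metric

/-! ### Weak directional derivatives and mollification -/

lemma IsTestFunction.continuous {X : Type*} [NormedAddCommGroup X] [NormedSpace ℝ X]
    {U : Set X} {φ : X → ℝ} (h : IsTestFunction U φ) : Continuous φ := h.1.continuous

lemma IsTestFunction.eq_zero {X : Type*} [NormedAddCommGroup X] [NormedSpace ℝ X]
    {U : Set X} {φ : X → ℝ} (h : IsTestFunction U φ) {x : X} (hx : x ∉ U) : φ x = 0 :=
  image_eq_zero_of_notMem_tsupport fun h' => hx (h.2.2 h')

lemma IsTestFunction.continuous_fderiv_apply {X : Type*} [NormedAddCommGroup X] [NormedSpace ℝ X]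
    {U : Set X} {φ : X → ℝ} (h : IsTestFunction U φ) (v : X) :
    Continuous fun x => fderiv ℝ φ x v :=
  (h.1.continuous_fderiv (by simp)).clm_apply continuous_const

lemma fderiv_apply_eq_zero_of_notMem_tsupport {X : Type*} [NormedAddCommGroup X]
    [NormedSpace ℝ X] {φ : X → ℝ} {x : X} (hx : x ∉ tsupport φ) (v : X) :
    fderiv ℝ φ x v = 0 := by
  have : fderiv ℝ φ x = 0 := image_eq_zero_of_notMem_tsupport
    fun h => hx (tsupport_fderiv_subset ℝ h)
  simp [this]

lemma IsTestFunction.hasCompactSupport_fderiv_apply {X : Type*} [NormedAddCommGroup X]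
    [NormedSpace ℝ X] {U : Set X} {φ : X → ℝ} (h : IsTestFunction U φ) (v : X) :
    HasCompactSupport fun x => fderiv ℝ φ x v :=
  h.2.1.mono' fun x hx => by
    by_contra hx'
    exact hx (fderiv_apply_eq_zero_of_notMem_tsupport hx' v)

/-- Bump functions with supports of radius at most `δ` that shrink to a point. The bound on the
ratio of the radii is what the Lebesgue differentiation theorem needs. -/
lemma exists_shrinking_bump (E : Type*) [NormedAddCommGroup E] {δ : ℝ} (hδ : 0 < δ) :
    ∃ r : ℕ → ContDiffBump (0 : E), Tendsto (fun n => (r n).rOut) atTop (𝓝 0) ∧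
      (∀ n, (r n).rOut ≤ δ) ∧ ∀ n, (r n).rOut ≤ 2 * (r n).rIn := by
  refine ⟨fun n => ⟨δ / 2 * (1 / (n + 1)), δ * (1 / (n + 1)), by positivity,
    by gcongr; linarith⟩, ?_, fun n => ?_, fun n => ?_⟩
  · simpa using (tendsto_one_div_add_atTop_nhds_zero_nat (𝕜 := ℝ)).const_mul δ
  · refine mul_le_of_le_one_right hδ.le ?_
    rw [div_le_one (by positivity)]
    linarith [n.cast_nonneg (α := ℝ)]
  · refine le_of_eq ?_
    simp only
    ring

section WeakDerivative

variable {E : Type*} [NormedAddCommGroup E] [NormedSpace ℝ E] [FiniteDimensional ℝ E]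
  [MeasureSpace E]

/-- `h` is the weak derivative of `f` on `U` in the direction `v`. Integrability of `f` and `h` is
not part of the definition; it is assumed separately where it is needed. -/
def HasWeakDeriv (U : Set E) (f h : E → ℝ) (v : E) : Prop :=
  ∀ φ : E → ℝ, IsTestFunction U φ →
    ∫ x in U, f x * fderiv ℝ φ x v = -∫ x in U, h x * φ x

/-- The convolution of `f` with the normalised bump function `ρ`. -/
noncomputable def mollify (ρ : ContDiffBump (0 : E)) (f : E → ℝ) : E → ℝ :=
  convolution (ρ.normed volume) f (ContinuousLinearMap.lsmul ℝ ℝ) volume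

lemma mollify_apply' (ρ : ContDiffBump (0 : E)) (f : E → ℝ) (x : E) :
    mollify ρ f x = ∫ y, ρ.normed volume y * f (x - y) := by
  simp [mollify, convolution_def]

variable [BorelSpace E] [(volume : Measure E).IsAddHaarMeasure]

lemma mollify_apply (ρ : ContDiffBump (0 : E)) (f : E → ℝ) (x : E) :
    mollify ρ f x = ∫ y, ρ.normed volume (x - y) * f y := by
  simp [mollify, convolution_eq_swap]

lemma hasFDerivAt_mollify (ρ : ContDiffBump (0 : E)) {f : E → ℝ}
    (hf : LocallyIntegrable f) (x : E) :
    HasFDerivAt (mollify ρ f) (convolution (fderiv ℝ (ρ.normed volume)) f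
      ((ContinuousLinearMap.lsmul ℝ ℝ).precompL E) volume x) x :=
  ρ.hasCompactSupport_normed.hasFDerivAt_convolution_left _
    (ρ.contDiff_normed (n := 1)) hf x

lemma contDiff_mollify (ρ : ContDiffBump (0 : E)) {f : E → ℝ}
    (hf : LocallyIntegrable f) : ContDiff ℝ 1 (mollify ρ f) :=
  ρ.hasCompactSupport_normed.contDiff_convolution_left _
    (ρ.contDiff_normed (n := 1)) hf

lemma continuous_mollify (ρ : ContDiffBump (0 : E)) {f : E → ℝ}
    (hf : LocallyIntegrable f) : Continuous (mollify ρ f) :=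
  (contDiff_mollify ρ hf).continuous

/-- Mollification does not increase a uniform bound which holds on the ball that it averages
over. -/
lemma abs_mollify_le (ρ : ContDiffBump (0 : E)) {f : E → ℝ} {C : ℝ} {x : E}
    (hC : ∀ y ∈ ball x ρ.rOut, |f y| ≤ C) : |mollify ρ f x| ≤ C := by
  rw [mollify_apply']
  have hb : ∀ y, ‖ρ.normed volume y * f (x - y)‖ ≤ ρ.normed volume y * C := by
    intro y
    rw [norm_mul, Real.norm_of_nonneg (ρ.nonneg_normed y)]
    by_cases hy : y ∈ ball (0 : E) ρ.rOut
    · refine mul_le_mul_of_nonneg_left (hC _ ?_) (ρ.nonneg_normed y)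
      simpa [mem_ball, dist_eq_norm] using hy
    · rw [← ρ.support_normed_eq (μ := volume), Function.notMem_support] at hy
      simp [hy]
  calc |∫ y, ρ.normed volume y * f (x - y)| ≤ ∫ y, ρ.normed volume y * C :=
        norm_integral_le_of_norm_le (ρ.integrable_normed.mul_const C) (.of_forall hb)
    _ = C := by rw [integral_mul_const, ρ.integral_normed, one_mul]

lemma isTestFunction_bump {U : Set E} (ρ : ContDiffBump (0 : E)) {x : E}
    (hx : closedBall x ρ.rOut ⊆ U) :
    IsTestFunction U (fun y => ρ.normed volume (x - y)) := by
  have hψs : tsupport (fun y => ρ.normed volume (x - y)) ⊆ closedBall x ρ.rOut := by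
    refine closure_minimal ?_ isClosed_closedBall
    intro y hy
    have : x - y ∈ Function.support (ρ.normed (volume : Measure E)) := hy
    rw [ρ.support_normed_eq, mem_ball_zero_iff] at this
    rw [mem_closedBall, dist_comm, dist_eq_norm]
    exact this.le
  exact ⟨(ρ.contDiff_normed (n := ⊤)).comp (contDiff_const.sub contDiff_id),
    (isCompact_closedBall x ρ.rOut).of_isClosed_subset (isClosed_tsupport _) hψs, hψs.trans hx⟩

/-- Mollification commutes with weak differentiation at points whose distance to the complement
of `U` exceeds the mollification radius. -/
lemma fderiv_mollify_eq {U : Set E} (hU : IsOpen U) {f h : E → ℝ} {v : E}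
    (hf : IntegrableOn f U) (hw : HasWeakDeriv U f h v)
    (ρ : ContDiffBump (0 : E)) {x : E} (hx : closedBall x ρ.rOut ⊆ U) :
    fderiv ℝ (mollify ρ (U.indicator f)) x v = mollify ρ (U.indicator h) x := by
  have hfi : Integrable (U.indicator f) := hf.integrable_indicator hU.measurableSet
  rw [(hasFDerivAt_mollify ρ hfi.locallyIntegrable x).fderiv, mollify_apply, convolution_eq_swap]
  set ψ : E → ℝ := fun y => ρ.normed volume (x - y) with hψ
  have hψt : IsTestFunction U ψ := isTestFunction_bump ρ hx
  have hder : ∀ y, fderiv ℝ ψ y v = -(fderiv ℝ (ρ.normed volume) (x - y) v) := by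
    intro y
    have h1 : HasFDerivAt (ρ.normed (volume : Measure E))
        (fderiv ℝ (ρ.normed volume) (x - y)) (x - y) :=
      ((ρ.contDiff_normed (n := 1)).differentiable one_ne_zero).differentiableAt.hasFDerivAt
    have h2 := h1.comp y ((hasFDerivAt_id y).const_sub x)
    have h3 : fderiv ℝ ψ y = _ := h2.fderiv
    simp [h3]
  have hint : Integrable (fun y => ((ContinuousLinearMap.lsmul ℝ ℝ).precompL E)
      (fderiv ℝ (ρ.normed volume) (x - y)) (U.indicator f y)) := by
    have := (ρ.hasCompactSupport_normed (μ := (volume : Measure E))).fderiv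
      (𝕜 := ℝ) |>.convolutionExists_left (L := ((ContinuousLinearMap.lsmul ℝ ℝ).precompL E))
      (μ := volume) ((ρ.contDiff_normed (n := 1)).continuous_fderiv one_ne_zero)
      hfi.locallyIntegrable x
    exact this.integrable_swap
  rw [ContinuousLinearMap.integral_apply hint]
  have h3 := hw ψ hψt
  rw [← integral_indicator hU.measurableSet, ← integral_indicator hU.measurableSet] at h3
  rw [← neg_inj, ← integral_neg]
  convert h3 using 1
  · refine integral_congr_ae (.of_forall fun y => ?_)
    by_cases hy : y ∈ U <;> simp [hy, hder, ContinuousLinearMap.precompL_apply, mul_comm]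
  · congr 1
    refine integral_congr_ae (.of_forall fun y => ?_)
    by_cases hy : y ∈ U <;> simp [hy, hψ, mul_comm]

/-- Mollification is symmetric, because bump functions are even. -/
lemma integral_mollify_mul (ρ : ContDiffBump (0 : E)) {h ζ : E → ℝ}
    (hh : Integrable h) (hζ : Integrable ζ) :
    ∫ x, mollify ρ h x * ζ x = ∫ y, h y * mollify ρ ζ y := by
  have hint : Integrable (fun z : E × E => ρ.normed volume (z.1 - z.2) * (ζ z.1 * h z.2))
      (volume.prod volume) := by
    obtain ⟨C, hC⟩ :=
      (ρ.hasCompactSupport_normed (μ := (volume : Measure E))).exists_bound_of_continuous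
      ρ.continuous_normed
    refine (hζ.mul_prod hh).bdd_mul (c := C) ?_ (.of_forall fun z => hC _)
    exact (ρ.continuous_normed.comp (continuous_fst.sub continuous_snd)).aestronglyMeasurable
  have h1 := integral_integral_swap (f := fun x y => ρ.normed volume (x - y) * (ζ x * h y)) hint
  convert h1 using 1
  · refine integral_congr_ae (.of_forall fun x => ?_)
    simp only [mollify_apply, ← integral_mul_const]
    refine integral_congr_ae (.of_forall fun y => ?_)
    simp only; ring
  · refine integral_congr_ae (.of_forall fun y => ?_)
    simp only [mollify_apply, ← integral_const_mul]
    refine integral_congr_ae (.of_forall fun x => ?_)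
    simp only
    rw [← ρ.normed_neg, neg_sub]; ring

/-- The mollifications of `f` converge locally uniformly near every point of continuity. -/
lemma tendsto_mollify_uncurry {r : ℕ → ContDiffBump (0 : E)}
    (hr : Tendsto (fun n => (r n).rOut) atTop (𝓝 0)) {f : E → ℝ}
    (hf : AEStronglyMeasurable f volume) {x : E} (hx : ContinuousAt f x) :
    Tendsto (fun z : ℕ × E => mollify (r z.1) f z.2) (atTop ×ˢ 𝓝 x) (𝓝 (f x)) :=
  ContDiffBump.convolution_tendsto_right (φ := fun z : ℕ × E => r z.1)
    (hr.comp tendsto_fst) (.of_forall fun _ => hf)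
    (hx.tendsto.comp tendsto_snd) tendsto_snd

lemma tendsto_mollify {r : ℕ → ContDiffBump (0 : E)}
    (hr : Tendsto (fun n => (r n).rOut) atTop (𝓝 0)) {f : E → ℝ}
    (hf : AEStronglyMeasurable f volume) {x : E} (hx : ContinuousAt f x) :
    Tendsto (fun n => mollify (r n) f x) atTop (𝓝 (f x)) :=
  ContDiffBump.convolution_tendsto_right hr (.of_forall fun _ => hf)
    (hx.tendsto.comp tendsto_snd) tendsto_const_nhds

lemma ae_tendsto_mollify {r : ℕ → ContDiffBump (0 : E)}
    (hr : Tendsto (fun n => (r n).rOut) atTop (𝓝 0)) (hr' : ∀ n, (r n).rOut ≤ 2 * (r n).rIn)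
    {f : E → ℝ} (hf : LocallyIntegrable f volume) :
    ∀ᵐ x : E, Tendsto (fun n => mollify (r n) f x) atTop (𝓝 (f x)) :=
  ContDiffBump.ae_convolution_tendsto_right_of_locallyIntegrable (K := 2) hr (.of_forall hr') hf

/-- A `C¹` function has its classical derivative as weak derivative. -/
lemma ContDiff.hasWeakDeriv {f : E → ℝ} (hf : ContDiff ℝ 1 f) {U : Set E} (v : E) :
    HasWeakDeriv U f (fun x => fderiv ℝ f x v) v := by
  intro φ hφ
  rw [setIntegral_eq_integral_of_forall_compl_eq_zero,
    setIntegral_eq_integral_of_forall_compl_eq_zero]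
  · have hfd : Continuous fun x => fderiv ℝ f x v :=
      (hf.continuous_fderiv one_ne_zero).clm_apply continuous_const
    refine integral_mul_fderiv_eq_neg_fderiv_mul_of_integrable ?_ ?_ ?_ ?_ ?_
    · exact (hfd.mul hφ.continuous).integrable_of_hasCompactSupport hφ.2.1.mul_left
    · exact (hf.continuous.mul (hφ.continuous_fderiv_apply v)).integrable_of_hasCompactSupport
        (hφ.hasCompactSupport_fderiv_apply v).mul_left
    · exact (hf.continuous.mul hφ.continuous).integrable_of_hasCompactSupport hφ.2.1.mul_left
    · exact fun x _ => (hf.differentiable one_ne_zero).differentiableAt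
    · exact fun x _ => (hφ.1.differentiable (by simp)).differentiableAt
  · intro x hx
    simp [hφ.eq_zero hx]
  · intro x hx
    rw [fderiv_apply_eq_zero_of_notMem_tsupport (fun h => hx (hφ.2.2 h)), mul_zero]

/-- Chain rule for weak derivatives of continuous functions. It is classical for the
mollifications of `f`; in the limit the derivative term is handled by moving the mollification
from the merely integrable `h` to the factor `β' ∘ f_n * φ`, which converges everywhere. -/
lemma HasWeakDeriv.comp {U : Set E} (hU : IsOpen U) {f h : E → ℝ} {v : E}
    (hw : HasWeakDeriv U f h v) (hfc : ContinuousOn f U) (hf : IntegrableOn f U)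
    (hh : IntegrableOn h U) {β β' : ℝ → ℝ} (hβ : ∀ s, HasDerivAt β (β' s) s)
    (hβ' : Continuous β') :
    HasWeakDeriv U (fun x => β (f x)) (fun x => β' (f x) * h x) v := by
  intro φ hφ
  have hβc : Continuous β := continuous_iff_continuousAt.2 fun s => (hβ s).continuousAt
  have hβ1 : ContDiff ℝ 1 β := by
    rw [contDiff_one_iff_deriv]
    refine ⟨fun s => (hβ s).differentiableAt, ?_⟩
    rwa [show deriv β = β' from funext fun s => (hβ s).deriv]
  set K := tsupport φ with hK
  have hKc : IsCompact K := hφ.2.1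
  have hfi : Integrable (U.indicator f) := hf.integrable_indicator hU.measurableSet
  have hhi : Integrable (U.indicator h) := hh.integrable_indicator hU.measurableSet
  obtain ⟨δ, hδ, hKU⟩ := hKc.exists_cthickening_subset_open hU hφ.2.2
  obtain ⟨r, hr0, hr, -⟩ := exists_shrinking_bump E hδ
  obtain ⟨F, hF⟩ : ∃ F : ℕ → E → ℝ, ∀ n, F n = mollify (r n) (U.indicator f) :=
    ⟨_, fun _ => rfl⟩
  have hball : ∀ n, ∀ x ∈ K, closedBall x (r n).rOut ⊆ cthickening δ K :=
    fun n x hx => (closedBall_subset_closedBall (hr n)).trans (closedBall_subset_cthickening hx δ)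
  obtain ⟨M, hM⟩ := (hKc.cthickening (r := δ)).exists_bound_of_continuousOn (hfc.mono hKU)
  have hFM : ∀ n, ∀ x ∈ K, |F n x| ≤ M := by
    intro n x hx
    rw [hF]
    refine abs_mollify_le _ fun y hy => ?_
    have hy' := hball n x hx (ball_subset_closedBall hy)
    simpa [hKU hy'] using hM y hy'
  have hFc : ∀ n, ContDiff ℝ 1 (F n) := fun n => by
    rw [hF]
    exact contDiff_mollify _ hfi.locallyIntegrable
  have hFt : ∀ x ∈ U, Tendsto (fun z : ℕ × E => F z.1 z.2) (atTop ×ˢ 𝓝 x) (𝓝 (f x)) := by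
    intro x hx
    have hcont : ContinuousAt (U.indicator f) x := by
      refine (hfc.continuousAt (hU.mem_nhds hx)).congr ?_
      filter_upwards [hU.mem_nhds hx] with y hy
      simp [hy]
    have := tendsto_mollify_uncurry hr0 hfi.aestronglyMeasurable hcont
    rw [indicator_of_mem hx] at this
    simpa only [hF] using this
  have hFt' : ∀ x ∈ U, Tendsto (fun n => F n x) atTop (𝓝 (f x)) := fun x hx =>
    (hFt x hx).comp (tendsto_id.prodMk (tendsto_const_nhds (x := x)))
  -- the classical identity for the mollified function
  obtain ⟨ζ, hζ⟩ : ∃ ζ : ℕ → E → ℝ, ∀ n x, ζ n x = β' (F n x) * φ x := ⟨_, fun _ _ => rfl⟩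
  have hζK : ∀ n, ∀ x ∉ K, ζ n x = 0 := fun n x hx => by
    rw [hζ, image_eq_zero_of_notMem_tsupport hx, mul_zero]
  have hζc : ∀ n, Continuous (ζ n) := fun n => by
    rw [show ζ n = fun x => β' (F n x) * φ x from funext (hζ n)]
    exact (hβ'.comp (hFc n).continuous).mul hφ.continuous
  have hζi : ∀ n, Integrable (ζ n) := fun n =>
    (hζc n).integrable_of_hasCompactSupport (HasCompactSupport.intro hKc (hζK n))
  have hid : ∀ n, ∫ x, β (F n x) * fderiv ℝ φ x v
      = -∫ y, U.indicator h y * mollify (r n) (ζ n) y := by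
    intro n
    have h0 : ContDiff ℝ 1 fun x => β (F n x) := hβ1.comp (hFc n)
    have h1 := ContDiff.hasWeakDeriv (U := univ) h0 v φ ⟨hφ.1, hφ.2.1, subset_univ _⟩
    rw [Measure.restrict_univ] at h1
    rw [h1, ← integral_mollify_mul _ hhi (hζi n)]
    congr 1
    refine integral_congr_ae (.of_forall fun x => ?_)
    by_cases hx : x ∈ K
    · have h2 : fderiv ℝ (F n) x v = mollify (r n) (U.indicator h) x := by
        rw [hF]
        exact fderiv_mollify_eq hU hf hw _ ((hball n x hx).trans hKU)
      have h3 : HasFDerivAt (fun x => β (F n x)) (β' (F n x) • fderiv ℝ (F n) x) x :=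
        (hβ (F n x)).comp_hasFDerivAt x
          ((hFc n).differentiable one_ne_zero).differentiableAt.hasFDerivAt
      simp only [h3.fderiv, hζ, ← h2]
      simp only [_root_.smul_apply, smul_eq_mul]
      ring
    · simp [hζK n x hx, image_eq_zero_of_notMem_tsupport hx]
  -- the left-hand sides converge
  obtain ⟨B, hB⟩ := (isCompact_Icc (a := -M) (b := M)).exists_bound_of_continuousOn
    hβc.continuousOn
  obtain ⟨B', hB'⟩ := (isCompact_Icc (a := -M) (b := M)).exists_bound_of_continuousOn
    hβ'.continuousOn
  have hL : Tendsto (fun n => ∫ x, β (F n x) * fderiv ℝ φ x v) atTop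
      (𝓝 (∫ x, β (f x) * fderiv ℝ φ x v)) := by
    have hφi : Integrable (fun x => fderiv ℝ φ x v) :=
      (hφ.continuous_fderiv_apply v).integrable_of_hasCompactSupport
        (hφ.hasCompactSupport_fderiv_apply v)
    refine tendsto_integral_of_dominated_convergence (fun x => B * ‖fderiv ℝ φ x v‖)
      (fun n => ((hβc.comp (hFc n).continuous).mul
        (hφ.continuous_fderiv_apply v)).aestronglyMeasurable)
      (hφi.norm.const_mul B) (fun n => .of_forall fun x => ?_) (.of_forall fun x => ?_)
    · by_cases hx : x ∈ K
      · rw [norm_mul]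
        exact mul_le_mul_of_nonneg_right (hB _ (abs_le.1 (hFM n x hx))) (norm_nonneg _)
      · simp [fderiv_apply_eq_zero_of_notMem_tsupport hx]
    · by_cases hx : x ∈ K
      · exact ((hβc.tendsto _).comp (hFt' x (hφ.2.2 hx))).mul_const _
      · simp [fderiv_apply_eq_zero_of_notMem_tsupport hx]
  -- the right-hand sides converge
  obtain ⟨Cφ, hCφ⟩ := hφ.2.1.exists_bound_of_continuous hφ.continuous
  have hζb : ∀ n x, |ζ n x| ≤ |B'| * |Cφ| := by
    intro n x
    by_cases hx : x ∈ K
    · rw [hζ, abs_mul]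
      exact mul_le_mul ((hB' _ (abs_le.1 (hFM n x hx))).trans (le_abs_self _))
        ((hCφ x).trans (le_abs_self _)) (abs_nonneg _) (abs_nonneg _)
    · rw [hζK n x hx, abs_zero]
      positivity
  have hζt : ∀ x, Tendsto (fun n => mollify (r n) (ζ n) x) atTop
      (𝓝 (β' (f x) * φ x)) := by
    intro x
    refine ContDiffBump.convolution_tendsto_right
      hr0 (.of_forall fun n => (hζc n).aestronglyMeasurable) ?_ tendsto_const_nhds
    by_cases hx : x ∈ K
    · have := ((hβ'.tendsto _).comp (hFt x (hφ.2.2 hx))).mul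
        ((hφ.continuous.tendsto x).comp tendsto_snd)
      exact this.congr fun z => (hζ z.1 z.2).symm
    · have hev : ∀ᶠ z : ℕ × E in atTop ×ˢ 𝓝 x, 0 = Function.uncurry ζ z := by
        have : ∀ᶠ y in 𝓝 x, y ∉ K := (isClosed_tsupport φ).isOpen_compl.mem_nhds hx
        filter_upwards [tendsto_snd.eventually this] with z hz
        exact (hζK z.1 z.2 hz).symm
      rw [image_eq_zero_of_notMem_tsupport hx, mul_zero]
      exact tendsto_const_nhds.congr' hev
  have hR : Tendsto (fun n => -∫ y, U.indicator h y * mollify (r n) (ζ n) y)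
      atTop (𝓝 (-∫ y, U.indicator h y * (β' (f y) * φ y))) := by
    refine Tendsto.neg (tendsto_integral_of_dominated_convergence
      (fun y => ‖U.indicator h y‖ * (|B'| * |Cφ|)) (fun n => ?_) (hhi.norm.mul_const _)
      (fun n => .of_forall fun y => ?_) (.of_forall fun y => (hζt y).const_mul _))
    · exact hhi.aestronglyMeasurable.mul
        (continuous_mollify _ (hζi n).locallyIntegrable).aestronglyMeasurable
    · rw [norm_mul]
      exact mul_le_mul_of_nonneg_left (abs_mollify_le _ fun z _ => hζb n z) (norm_nonneg _)
  have hfinal := tendsto_nhds_unique (hL.congr hid) hR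
  rw [← integral_indicator hU.measurableSet, ← integral_indicator hU.measurableSet]
  convert hfinal using 1
  · refine integral_congr_ae (.of_forall fun x => ?_)
    by_cases hx : x ∈ U
    · simp [hx]
    · simp [hx, fderiv_apply_eq_zero_of_notMem_tsupport (fun h' => hx (hφ.2.2 h'))]
  · congr 1
    refine integral_congr_ae (.of_forall fun x => ?_)
    by_cases hx : x ∈ U
    · simp only [hx, indicator_of_mem]; ring
    · simp [hx]

end WeakDerivative

/-! ### Weak time derivatives on cylinders -/

/-- A continuous function on an interval whose weak derivative vanishes is constant, because its
mollifications are. -/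
lemma HasWeakDeriv.eq_of_zero {a b : ℝ} {z : ℝ → ℝ} (hz : ContinuousOn z (Ioo a b))
    (hzi : IntegrableOn z (Ioo a b)) (hw : HasWeakDeriv (Ioo a b) z (fun _ => 0) 1)
    {c d : ℝ} (hc : c ∈ Ioo a b) (hd : d ∈ Ioo a b) (hcd : c < d) : z d = z c := by
  have hK : IsCompact (Icc c d) := isCompact_Icc
  have hsub : Icc c d ⊆ Ioo a b := fun x hx => ⟨hc.1.trans_le hx.1, hx.2.trans_lt hd.2⟩
  obtain ⟨δ, hδ, hδU⟩ := hK.exists_cthickening_subset_open isOpen_Ioo hsub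
  obtain ⟨r, hr0, hr, -⟩ := exists_shrinking_bump ℝ hδ
  have hI : Integrable ((Ioo a b).indicator z) := hzi.integrable_indicator measurableSet_Ioo
  have hlim : ∀ x ∈ Ioo a b, Tendsto
      (fun n => mollify (r n) ((Ioo a b).indicator z) x) atTop (𝓝 (z x)) := by
    intro x hx
    have hcont : ContinuousAt ((Ioo a b).indicator z) x := by
      refine (hz.continuousAt (isOpen_Ioo.mem_nhds hx)).congr ?_
      filter_upwards [isOpen_Ioo.mem_nhds hx] with y hy
      simp [hy]
    have h1 := tendsto_mollify hr0 hI.aestronglyMeasurable hcont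
    rw [indicator_of_mem hx] at h1
    exact h1
  refine tendsto_nhds_unique (hlim d hd) ((hlim c hc).congr fun n => ?_)
  obtain ⟨m, hm⟩ : ∃ m, m = mollify (r n) ((Ioo a b).indicator z) := ⟨_, rfl⟩
  have hC : ContDiff ℝ 1 m := hm ▸ contDiff_mollify _ hI.locallyIntegrable
  rw [← hm]
  obtain ⟨x, hx, hxe⟩ := exists_deriv_eq_slope m hcd hC.continuous.continuousOn
    (hC.differentiable one_ne_zero).differentiableOn
  have hx0 : deriv m x = 0 := by
    rw [← fderiv_apply_one_eq_deriv, hm, fderiv_mollify_eq isOpen_Ioo hzi hw]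
    · simp [mollify_apply]
    · exact ((closedBall_subset_closedBall (hr n)).trans
        (closedBall_subset_cthickening (Ioo_subset_Icc_self hx) δ)).trans hδU
  rw [hx0, eq_comm, div_eq_zero_iff] at hxe
  rcases hxe with h | h <;> linarith

/-- The fundamental theorem of calculus for weak derivatives in dimension one: a primitive of `H`
has the same weak derivative as `y`, hence differs from it by a constant. -/
lemma HasWeakDeriv.sub_eq_integral {s : ℝ} (hs : 0 < s) {y H : ℝ → ℝ}
    (hy : ContinuousOn y (Icc 0 s)) (hH : IntegrableOn H (Ioo 0 s))
    (hw : HasWeakDeriv (Ioo 0 s) y H 1) : y s - y 0 = ∫ t in Ioo 0 s, H t := by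
  have hHi : IntervalIntegrable H volume 0 s :=
    (intervalIntegrable_iff_integrableOn_Ioo_of_le hs.le).2 hH
  obtain ⟨P, hP⟩ : ∃ P : ℝ → ℝ, P = fun t => ∫ r in (0 : ℝ)..t, H r := ⟨_, rfl⟩
  have hPac : AbsolutelyContinuousOnInterval P 0 s :=
    hP ▸ hHi.absolutelyContinuousOnInterval_intervalIntegral (c := 0) (by simp [hs.le])
  have hPc : ContinuousOn P (Icc 0 s) := by simpa [uIcc_of_le hs.le] using hPac.continuousOn
  have hPd : ∀ᵐ t, t ∈ uIcc 0 s → deriv P t = H t := by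
    filter_upwards [hHi.ae_hasDerivAt_integral] with t ht hts
    rw [hP]
    exact (ht hts 0 (by simp)).deriv
  have hIoo : ∀ f : ℝ → ℝ, ∫ t in Ioo 0 s, f t = ∫ t in (0 : ℝ)..s, f t := fun f => by
    rw [intervalIntegral.integral_of_le hs.le, integral_Ioc_eq_integral_Ioo]
  have hyI : IntegrableOn y (Icc 0 s) := hy.integrableOn_Icc
  have hPI : IntegrableOn P (Icc 0 s) := hPc.integrableOn_Icc
  have hPw : HasWeakDeriv (Ioo 0 s) P H 1 := by
    intro φ hφ
    rw [hIoo, hIoo]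
    have hφac : AbsolutelyContinuousOnInterval φ 0 s :=
      (hφ.1.of_le (by simp)).contDiffOn.absolutelyContinuousOnInterval
    have h1 := hPac.integral_mul_deriv_eq_deriv_mul hφac
    have h0 : φ 0 = 0 := hφ.eq_zero (by simp)
    have hs' : φ s = 0 := hφ.eq_zero (by simp)
    simp only [h0, hs', mul_zero, sub_zero, zero_sub] at h1
    simp only [fderiv_apply_one_eq_deriv]
    rw [h1]
    congr 1
    refine intervalIntegral.integral_congr_ae ?_
    filter_upwards [hPd] with t ht hts
    rw [ht (uIoc_subset_uIcc hts)]
  have hz : HasWeakDeriv (Ioo 0 s) (fun t => y t - P t) (fun _ => 0) 1 := by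
    intro φ hφ
    obtain ⟨C, hC⟩ := (hφ.hasCompactSupport_fderiv_apply 1).exists_bound_of_continuous
      (hφ.continuous_fderiv_apply 1)
    have hi : ∀ f : ℝ → ℝ, IntegrableOn f (Icc 0 s) →
        IntegrableOn (fun t => f t * fderiv ℝ φ t 1) (Ioo 0 s) := fun f hf =>
      (hf.mono_set Ioo_subset_Icc_self).mul_bdd (c := C)
        (hφ.continuous_fderiv_apply 1).aestronglyMeasurable (.of_forall hC)
    simp only [sub_mul, zero_mul, integral_zero, neg_zero]
    rw [integral_sub (hi y hyI) (hi P hPI), hw φ hφ, hPw φ hφ, sub_self]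
  have hzc : ContinuousOn (fun t => y t - P t) (Icc 0 s) := hy.sub hPc
  have hzi := (hyI.sub hPI).mono_set (Ioo_subset_Icc_self (a := (0 : ℝ)) (b := s))
  have hmid : s / 2 ∈ Ioo 0 s := ⟨by linarith, by linarith⟩
  have hconst : EqOn (fun t => y t - P t) (fun _ => y (s / 2) - P (s / 2)) (Ioo 0 s) := by
    intro t ht
    rcases lt_trichotomy t (s / 2) with h | h | h
    · exact (hz.eq_of_zero (hzc.mono Ioo_subset_Icc_self) hzi ht hmid h).symm
    · simp [h]
    · exact hz.eq_of_zero (hzc.mono Ioo_subset_Icc_self) hzi hmid ht h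
  have hE := hconst.of_subset_closure hzc continuousOn_const Ioo_subset_Icc_self
    (by rw [closure_Ioo hs.ne])
  have e0 := hE (left_mem_Icc.2 hs.le)
  have es := hE (right_mem_Icc.2 hs.le)
  have hP0 : P 0 = 0 := by simp [hP]
  have hPs : P s = ∫ t in Ioo 0 s, H t := by rw [hIoo, hP]
  simp only at e0 es
  rw [← hPs]
  linarith

variable {N : ℕ} {Ω : Set (EuclideanSpace ℝ (Fin N))}

lemma isOpen_cylinder (hΩ : IsOpen Ω) (s : ℝ) : IsOpen (cylinder Ω s) := hΩ.prod isOpen_Ioo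

lemma restrict_cylinder (Ω : Set (EuclideanSpace ℝ (Fin N))) (s : ℝ) :
    (volume.restrict (cylinder Ω s) : Measure (EuclideanSpace ℝ (Fin N) × ℝ)) =
      (volume.restrict Ω).prod (volume.restrict (Ioo 0 s)) := by
  rw [Measure.prod_restrict]; rfl

lemma integral_cylinder {s : ℝ} {f : EuclideanSpace ℝ (Fin N) × ℝ → ℝ}
    (hf : IntegrableOn f (cylinder Ω s)) :
    ∫ z in cylinder Ω s, f z = ∫ t in Ioo 0 s, ∫ x in Ω, f (x, t) := by
  rw [IntegrableOn, restrict_cylinder] at hf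
  rw [restrict_cylinder, integral_prod_symm _ hf]

lemma integrableOn_integral_slice {s : ℝ} {f : EuclideanSpace ℝ (Fin N) × ℝ → ℝ}
    (hf : IntegrableOn f (cylinder Ω s)) :
    IntegrableOn (fun t => ∫ x in Ω, f (x, t)) (Ioo 0 s) := by
  rw [IntegrableOn, restrict_cylinder] at hf
  exact hf.integral_prod_right

lemma ae_slice {s : ℝ} {P : EuclideanSpace ℝ (Fin N) × ℝ → Prop}
    (h : ∀ᵐ z ∂(volume.restrict (cylinder Ω s)), P z) :
    ∀ᵐ t ∂(volume.restrict (Ioo 0 s)), ∀ᵐ x ∂(volume.restrict Ω), P (x, t) := by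
  rw [restrict_cylinder] at h
  have h2 := (Measure.measurePreserving_swap (μ := volume.restrict (Ioo 0 s))
    (ν := volume.restrict Ω)).quasiMeasurePreserving.ae h
  exact Measure.ae_ae_of_ae_prod h2

lemma ae_slice_aestronglyMeasurable {F : Type*} [TopologicalSpace F]
    [TopologicalSpace.PseudoMetrizableSpace F] {s : ℝ} {f : EuclideanSpace ℝ (Fin N) × ℝ → F}
    (h : AEStronglyMeasurable f (volume.restrict (cylinder Ω s))) :
    ∀ᵐ t ∂(volume.restrict (Ioo 0 s)),
      AEStronglyMeasurable (fun x => f (x, t)) (volume.restrict Ω) := by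
  rw [restrict_cylinder] at h
  exact (h.comp_measurePreserving Measure.measurePreserving_swap).prodMk_left

/-- Integration in space of a function which is continuous up to the boundary. -/
lemma continuousOn_integral_slice (hb : Bornology.IsBounded Ω) (hΩ : IsOpen Ω) {s : ℝ}
    {W : EuclideanSpace ℝ (Fin N) × ℝ → ℝ} (hW : ContinuousOn W (closure Ω ×ˢ Icc 0 s)) :
    ContinuousOn (fun t => ∫ x in Ω, W (x, t)) (Icc 0 s) := by
  obtain ⟨C, hC⟩ := (hb.isCompact_closure.prod isCompact_Icc).exists_bound_of_continuousOn hW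
  have hfin : IsFiniteMeasure (volume.restrict Ω) :=
    ⟨by simpa using hb.measure_lt_top⟩
  refine continuousOn_of_dominated (bound := fun _ => C) (fun t ht => ?_) (fun t ht => ?_)
    (integrable_const C) ?_
  · refine ContinuousOn.aestronglyMeasurable ?_ hΩ.measurableSet
    exact hW.comp (by fun_prop) fun x hx => ⟨subset_closure hx, ht⟩
  · exact ae_restrict_of_forall_mem hΩ.measurableSet fun x hx => hC _ ⟨subset_closure hx, ht⟩
  · refine ae_restrict_of_forall_mem hΩ.measurableSet fun x hx => ?_
    exact hW.comp (by fun_prop) fun t ht => ⟨subset_closure hx, ht⟩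

lemma integrableOn_cylinder_of_continuousOn (hb : Bornology.IsBounded Ω) {s : ℝ}
    {W : EuclideanSpace ℝ (Fin N) × ℝ → ℝ} (hW : ContinuousOn W (closure Ω ×ˢ Icc 0 s)) :
    IntegrableOn W (cylinder Ω s) :=
  (hW.integrableOn_compact (hb.isCompact_closure.prod isCompact_Icc)).mono_set
    (prod_mono subset_closure Ioo_subset_Icc_self)

/-- Smooth cut-off functions with compact support in a bounded open set, with values in `[0, 1]`,
which converge to `1` pointwise on it. -/
lemma exists_cutoff (hΩ : IsOpen Ω) (hb : Bornology.IsBounded Ω) :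
    ∃ χ : ℕ → EuclideanSpace ℝ (Fin N) → ℝ, (∀ n, IsTestFunction Ω (χ n)) ∧
      (∀ n x, 0 ≤ χ n x ∧ χ n x ≤ 1) ∧
      ∀ x ∈ Ω, Tendsto (fun n => χ n x) atTop (𝓝 1) := by
  obtain ⟨f, hfs, hf, hf0⟩ := hΩ.exists_contDiff_support_eq (n := ⊤)
  refine ⟨fun n x => Real.smoothTransition (n * f x - 1), fun n => ?_, fun n x =>
    ⟨Real.smoothTransition.nonneg _, Real.smoothTransition.le_one _⟩, fun x hx => ?_⟩
  · have hsub : tsupport (fun x => Real.smoothTransition (n * f x - 1)) ⊆ {x | 1 ≤ n * f x} := by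
      refine closure_minimal (fun x hx => ?_) (isClosed_le continuous_const
        (continuous_const.mul hf.continuous))
      by_contra h
      exact hx (Real.smoothTransition.zero_of_nonpos (by
        have : ¬ 1 ≤ n * f x := h
        linarith))
    have hsub2 : {x | 1 ≤ n * f x} ⊆ Ω := by
      intro x hx
      rw [← hfs, Function.mem_support]
      intro h0
      have : (1 : ℝ) ≤ n * f x := hx
      rw [h0] at this
      norm_num at this
    refine ⟨Real.smoothTransition.contDiff.comp ((contDiff_const.mul hf).sub contDiff_const),
      ?_, hsub.trans hsub2⟩
    exact hb.isCompact_closure.of_isClosed_subset (isClosed_tsupport _)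
      ((hsub.trans hsub2).trans subset_closure)
  · have hfx : 0 < f x := lt_of_le_of_ne (hf0 ⟨x, rfl⟩).1 (Ne.symm (by
      rw [← hfs] at hx; exact hx))
    refine tendsto_const_nhds.congr' ?_
    obtain ⟨n₀, hn₀⟩ := exists_nat_gt (2 / f x)
    filter_upwards [eventually_ge_atTop n₀] with n hn
    refine (Real.smoothTransition.one_of_one_le ?_).symm
    have h1 : (n₀ : ℝ) ≤ n := by exact_mod_cast hn
    have h2 : 2 < n₀ * f x := by rwa [div_lt_iff₀ hfx] at hn₀
    nlinarith

lemma isTestFunction_mul {s : ℝ} {χ : EuclideanSpace ℝ (Fin N) → ℝ} {η : ℝ → ℝ}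
    (hχ : IsTestFunction Ω χ) (hη : IsTestFunction (Ioo 0 s) η) :
    IsTestFunction (cylinder Ω s) (fun z => χ z.1 * η z.2) := by
  have hsub : tsupport (fun z : EuclideanSpace ℝ (Fin N) × ℝ => χ z.1 * η z.2) ⊆
      tsupport χ ×ˢ tsupport η := by
    refine closure_minimal (fun z hz => ?_) ((isClosed_tsupport _).prod (isClosed_tsupport _))
    have hz' : χ z.1 * η z.2 ≠ 0 := hz
    exact ⟨subset_tsupport _ (left_ne_zero_of_mul hz'),
      subset_tsupport _ (right_ne_zero_of_mul hz')⟩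
  refine ⟨(hχ.1.comp contDiff_fst).mul (hη.1.comp contDiff_snd), ?_,
    hsub.trans (prod_mono hχ.2.2 hη.2.2)⟩
  exact (hχ.2.1.prod hη.2.1).of_isClosed_subset (isClosed_tsupport _) hsub

lemma fderiv_mul_time {χ : EuclideanSpace ℝ (Fin N) → ℝ} {η : ℝ → ℝ}
    {s : ℝ} (hχ : IsTestFunction Ω χ) (hη : IsTestFunction (Ioo 0 s) η)
    (z : EuclideanSpace ℝ (Fin N) × ℝ) :
    fderiv ℝ (fun z : EuclideanSpace ℝ (Fin N) × ℝ => χ z.1 * η z.2) z (0, 1) =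
      χ z.1 * fderiv ℝ η z.2 1 := by
  have h1 : HasFDerivAt χ (fderiv ℝ χ z.1) z.1 :=
    (hχ.1.differentiable (by simp)).differentiableAt.hasFDerivAt
  have h2 : HasFDerivAt η (fderiv ℝ η z.2) z.2 :=
    (hη.1.differentiable (by simp)).differentiableAt.hasFDerivAt
  have h3 : HasFDerivAt (fun z : EuclideanSpace ℝ (Fin N) × ℝ => χ z.1 * η z.2) _ z :=
    (h1.comp z hasFDerivAt_fst).mul (h2.comp z hasFDerivAt_snd)
  rw [h3.fderiv]
  simp

/-- The integral over `Q_s` of the weak time derivative of a function that is continuous on the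
closed cylinder is the difference of its integrals at the final and the initial time. -/
lemma integral_weak_time_deriv (hΩ : IsOpen Ω) (hb : Bornology.IsBounded Ω) {s : ℝ} (hs : 0 < s)
    {W h : EuclideanSpace ℝ (Fin N) × ℝ → ℝ} (hW : ContinuousOn W (closure Ω ×ˢ Icc 0 s))
    (hh : IntegrableOn h (cylinder Ω s)) (hw : HasWeakDeriv (cylinder Ω s) W h (0, 1)) :
    ∫ z in cylinder Ω s, h z = (∫ x in Ω, W (x, s)) - ∫ x in Ω, W (x, 0) := by
  obtain ⟨χ, hχ, hχ01, hχ1⟩ := exists_cutoff hΩ hb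
  have hfin : IsFiniteMeasure (volume.restrict Ω) := ⟨by simpa using hb.measure_lt_top⟩
  have hχb : ∀ n x, ‖χ n x‖ ≤ 1 := fun n x => by
    rw [Real.norm_of_nonneg (hχ01 n x).1]; exact (hχ01 n x).2
  have hχc : ∀ n, Continuous fun z : EuclideanSpace ℝ (Fin N) × ℝ => χ n z.1 := fun n =>
    (hχ n).continuous.comp continuous_fst
  have key : ∀ n, ∫ z in cylinder Ω s, h z * χ n z.1 =
      (∫ x in Ω, W (x, s) * χ n x) - ∫ x in Ω, W (x, 0) * χ n x := by
    intro n
    have hWχ : ContinuousOn (fun z => W z * χ n z.1) (closure Ω ×ˢ Icc 0 s) :=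
      hW.mul (hχc n).continuousOn
    have hhχ : IntegrableOn (fun z => h z * χ n z.1) (cylinder Ω s) :=
      hh.mul_bdd (c := 1) (hχc n).aestronglyMeasurable (.of_forall fun z => hχb n z.1)
    rw [integral_cylinder hhχ]
    refine (HasWeakDeriv.sub_eq_integral hs (y := fun t => ∫ x in Ω, W (x, t) * χ n x)
      (continuousOn_integral_slice hb hΩ hWχ) (integrableOn_integral_slice hhχ) ?_).symm
    intro η hη
    have h1 := hw _ (isTestFunction_mul (hχ n) hη)
    simp only [fderiv_mul_time (hχ n) hη] at h1
    obtain ⟨C, hC⟩ := hη.2.1.exists_bound_of_continuous hη.continuous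
    have hi1 : IntegrableOn (fun z : EuclideanSpace ℝ (Fin N) × ℝ =>
        W z * (χ n z.1 * fderiv ℝ η z.2 1)) (cylinder Ω s) := by
      refine integrableOn_cylinder_of_continuousOn hb (hW.mul ?_)
      exact ((hχc n).mul ((hη.continuous_fderiv_apply 1).comp continuous_snd)).continuousOn
    have hi2 : IntegrableOn (fun z : EuclideanSpace ℝ (Fin N) × ℝ =>
        h z * (χ n z.1 * η z.2)) (cylinder Ω s) := by
      have hηc : Continuous fun z : EuclideanSpace ℝ (Fin N) × ℝ => η z.2 :=
        hη.continuous.comp continuous_snd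
      have := hhχ.mul_bdd (c := C) hηc.aestronglyMeasurable (.of_forall fun z => hC z.2)
      simpa only [mul_assoc, IntegrableOn] using this
    rw [integral_cylinder hi1, integral_cylinder hi2] at h1
    simpa only [← mul_assoc, integral_mul_const] using h1
  have hΩs : ∀ t ∈ Icc 0 s, Tendsto (fun n => ∫ x in Ω, W (x, t) * χ n x) atTop
      (𝓝 (∫ x in Ω, W (x, t))) := by
    intro t ht
    obtain ⟨C, hC⟩ := (hb.isCompact_closure.prod isCompact_Icc).exists_bound_of_continuousOn hW
    have hm : AEStronglyMeasurable (fun x => W (x, t)) (volume.restrict Ω) :=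
      (hW.comp (by fun_prop) fun x hx => ⟨subset_closure hx, ht⟩ :
        ContinuousOn (fun x => W (x, t)) Ω).aestronglyMeasurable hΩ.measurableSet
    refine tendsto_integral_of_dominated_convergence (fun _ => C) (fun n =>
      hm.mul (hχ n).continuous.aestronglyMeasurable) (integrable_const C) (fun n => ?_) ?_
    · refine ae_restrict_of_forall_mem hΩ.measurableSet fun x hx => ?_
      rw [norm_mul]
      exact (mul_le_of_le_one_right (norm_nonneg _) (hχb n x)).trans
        (hC _ ⟨subset_closure hx, ht⟩)
    · refine ae_restrict_of_forall_mem hΩ.measurableSet fun x hx => ?_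
      simpa using (hχ1 x hx).const_mul (W (x, t))
  have hL : Tendsto (fun n => ∫ z in cylinder Ω s, h z * χ n z.1) atTop
      (𝓝 (∫ z in cylinder Ω s, h z)) := by
    refine tendsto_integral_of_dominated_convergence (fun z => ‖h z‖) (fun n =>
      hh.aestronglyMeasurable.mul (hχc n).aestronglyMeasurable) hh.norm
      (fun n => .of_forall fun z => ?_) ?_
    · rw [norm_mul]
      exact mul_le_of_le_one_right (norm_nonneg _) (hχb n z.1)
    · refine ae_restrict_of_forall_mem (isOpen_cylinder hΩ s).measurableSet fun z hz => ?_
      simpa using (hχ1 z.1 hz.1).const_mul (h z)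
  exact tendsto_nhds_unique (hL.congr key)
    ((hΩs s (right_mem_Icc.2 hs.le)).sub (hΩs 0 (left_mem_Icc.2 hs.le)))

/-! ### Elementary inequalities and Grönwall's lemma -/

/-- Quantitative monotonicity of the field `ξ ↦ |ξ|^r ξ`. -/
lemma inner_pow_smul_sub_ge {V : Type*} [NormedAddCommGroup V] [InnerProductSpace ℝ V]
    {r : ℝ} (hr : 0 ≤ r) (a b : V) :
    (‖a‖ ^ r + ‖b‖ ^ r) / 2 * ‖a - b‖ ^ 2 ≤
      ‖a‖ ^ r * inner ℝ a (a - b) - ‖b‖ ^ r * inner ℝ b (a - b) := by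
  have hd : ‖a - b‖ ^ 2 = ‖a‖ ^ 2 - 2 * inner ℝ a b + ‖b‖ ^ 2 := norm_sub_sq_real a b
  rw [inner_sub_right, inner_sub_right, real_inner_self_eq_norm_sq, real_inner_self_eq_norm_sq,
    real_inner_comm a b, hd]
  have hm : 0 ≤ (‖a‖ ^ r - ‖b‖ ^ r) * (‖a‖ ^ 2 - ‖b‖ ^ 2) := by
    rcases le_total ‖a‖ ‖b‖ with h | h
    · have h1 := Real.rpow_le_rpow (norm_nonneg a) h hr
      have h2 := pow_le_pow_left₀ (norm_nonneg a) h 2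
      exact mul_nonneg_of_nonpos_of_nonpos (by linarith) (by linarith)
    · have h1 := Real.rpow_le_rpow (norm_nonneg b) h hr
      have h2 := pow_le_pow_left₀ (norm_nonneg b) h 2
      exact mul_nonneg (by linarith) (by linarith)
  nlinarith

/-- A mean value bound for powers, obtained from Bernoulli's inequality. -/
lemma rpow_sub_rpow_le {x y q : ℝ} (hy : 0 ≤ y) (hyx : y ≤ x) (hq : 1 ≤ q) :
    x ^ q - y ^ q ≤ q * x ^ (q - 1) * (x - y) := by
  rcases (hy.trans hyx).eq_or_lt with h0 | hx
  · obtain rfl : y = x := le_antisymm hyx (h0 ▸ hy)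
    simp
  · have h1 := one_add_mul_self_le_rpow_one_add (s := y / x - 1)
      (by have := div_nonneg hy hx.le; linarith) hq
    rw [add_sub_cancel, Real.div_rpow hy hx.le, le_div_iff₀ (Real.rpow_pos_of_pos hx q)] at h1
    have h2 : x ^ q = x ^ (q - 1) * x := by
      rw [← Real.rpow_add_one hx.ne', sub_add_cancel]
    have h3 : (1 + q * (y / x - 1)) * x ^ q = x ^ q - q * x ^ (q - 1) * (x - y) := by
      rw [h2]
      field_simp
      ring
    linarith

/-- The pointwise estimate behind the comparison principle: the difference of the source terms
is absorbed by the monotonicity of the diffusion. The exponent `2q - p` of the gradient bound is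
nonnegative exactly because `q ≥ p / 2`. -/
lemma source_sub_diffusion_le {V : Type*} [NormedAddCommGroup V] [InnerProductSpace ℝ V]
    {p q M : ℝ} (hp : 2 ≤ p) (hq : p ≤ 2 * q) {a b : V} (ha : ‖a‖ ≤ M)
    {r : ℝ} (hr : 0 ≤ r) :
    (‖a‖ ^ q - ‖b‖ ^ q) * r ^ 2 -
      (‖a‖ ^ (p - 2) * inner ℝ a ((2 * r) • (a - b)) -
        ‖b‖ ^ (p - 2) * inner ℝ b ((2 * r) • (a - b))) ≤
      q ^ 2 / 4 * M ^ (2 * q - p) * r ^ 3 := by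
  have hmono := inner_pow_smul_sub_ge (r := p - 2) (by linarith) a b
  rw [inner_smul_right, inner_smul_right]
  set D := ‖a‖ ^ (p - 2) * inner ℝ a (a - b) - ‖b‖ ^ (p - 2) * inner ℝ b (a - b) with hD
  have hDe : ‖a‖ ^ (p - 2) * (2 * r * inner ℝ a (a - b)) -
      ‖b‖ ^ (p - 2) * (2 * r * inner ℝ b (a - b)) = 2 * r * D := by rw [hD]; ring
  rw [hDe]
  have hA : 0 ≤ ‖a‖ ^ (p - 2) := by positivity
  have hB : 0 ≤ ‖b‖ ^ (p - 2) := by positivity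
  have hM : 0 ≤ M := (norm_nonneg a).trans ha
  have hR : 0 ≤ q ^ 2 / 4 * M ^ (2 * q - p) * r ^ 3 := by positivity
  rcases le_total ‖a‖ ‖b‖ with h | h
  · have h1 := Real.rpow_le_rpow (norm_nonneg a) h (by linarith : (0 : ℝ) ≤ q)
    have h2 : 0 ≤ D := le_trans (by positivity) hmono
    have h3 : (‖a‖ ^ q - ‖b‖ ^ q) * r ^ 2 ≤ 0 :=
      mul_nonpos_of_nonpos_of_nonneg (by linarith) (by positivity)
    have h4 : 0 ≤ 2 * r * D := by positivity
    linarith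
  · have h1 := rpow_sub_rpow_le (norm_nonneg b) h (by linarith : (1 : ℝ) ≤ q)
    have hd : ‖a‖ - ‖b‖ ≤ ‖a - b‖ := norm_sub_norm_le a b
    set d := ‖a - b‖ with hd'
    set x := ‖a‖ ^ ((p - 2) / 2) with hx
    set y := ‖a‖ ^ ((2 * q - p) / 2) with hy
    have hxy : ‖a‖ ^ (q - 1) = x * y := by
      rw [hx, hy, ← Real.rpow_add_of_nonneg (norm_nonneg a) (by linarith) (by linarith)]
      congr 1; ring
    have hxx : ‖a‖ ^ (p - 2) = x ^ 2 := by
      rw [hx, ← Real.rpow_mul_natCast (norm_nonneg a)]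
      congr 1; push_cast; ring
    have hyy : y ^ 2 ≤ M ^ (2 * q - p) := by
      rw [hy, ← Real.rpow_mul_natCast (norm_nonneg a)]
      rw [show (2 * q - p) / 2 * ((2 : ℕ) : ℝ) = 2 * q - p by push_cast; ring]
      exact Real.rpow_le_rpow (norm_nonneg a) ha (by linarith)
    have hq0 : 0 ≤ q := by linarith
    have hx0 : 0 ≤ x := by positivity
    have hy0 : 0 ≤ y := by positivity
    have h2 : ‖a‖ ^ q - ‖b‖ ^ q ≤ q * (x * y) * d := by
      rw [← hxy]
      exact h1.trans (mul_le_mul_of_nonneg_left hd (by positivity))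
    have h3 : (‖a‖ ^ q - ‖b‖ ^ q) * r ^ 2 ≤ q * (x * y) * d * r ^ 2 :=
      mul_le_mul_of_nonneg_right h2 (by positivity)
    have h4 : x ^ 2 * d ^ 2 ≤ 2 * D := by
      have : 0 ≤ ‖b‖ ^ (p - 2) * d ^ 2 := by positivity
      rw [hxx] at hmono
      linarith
    have h5 : r * (x ^ 2 * d ^ 2) ≤ r * (2 * D) := mul_le_mul_of_nonneg_left h4 hr
    have h6 : q ^ 2 / 4 * r ^ 3 * y ^ 2 ≤ q ^ 2 / 4 * r ^ 3 * M ^ (2 * q - p) :=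
      mul_le_mul_of_nonneg_left hyy (by positivity)
    -- Young's inequality for the product of `x * d` and `q * (y * r)`
    have h7 : 0 ≤ r * (x * d - q / 2 * (y * r)) ^ 2 := by positivity
    nlinarith

lemma hasDerivAt_posPart_pow (n : ℕ) (s : ℝ) :
    HasDerivAt (fun s : ℝ => (max s 0) ^ (n + 2)) ((n + 2) * (max s 0) ^ (n + 1)) s := by
  rcases lt_trichotomy s 0 with h | h | h
  · rw [max_eq_right h.le]
    simp only [ne_eq, Nat.add_eq_zero_iff, one_ne_zero, and_false, not_false_eq_true, zero_pow,
      mul_zero]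
    refine (hasDerivAt_const s (0 : ℝ)).congr_of_eventuallyEq ?_
    filter_upwards [gt_mem_nhds h] with y hy
    simp [max_eq_right hy.le]
  · subst h
    rw [hasDerivAt_iff_tendsto_slope_zero]
    simp only [max_self, zero_add, smul_eq_mul, ne_eq, Nat.add_eq_zero_iff, one_ne_zero, and_false,
      not_false_eq_true, zero_pow, mul_zero, OfNat.ofNat_ne_zero, sub_zero]
    have hlim : Tendsto (fun h : ℝ => |h| ^ (n + 1)) (𝓝[≠] 0) (𝓝 0) := by
      have : Continuous fun h : ℝ => |h| ^ (n + 1) := by fun_prop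
      have h2 := this.tendsto 0
      simp only [abs_zero, ne_eq, Nat.add_eq_zero_iff, one_ne_zero, and_false, not_false_eq_true,
        zero_pow] at h2
      exact h2.mono_left nhdsWithin_le_nhds
    refine squeeze_zero_norm' ?_ hlim
    filter_upwards [self_mem_nhdsWithin] with t ht
    have ht0 : |t| ≠ 0 := abs_ne_zero.2 ht
    rw [norm_mul, norm_inv, Real.norm_eq_abs, norm_pow, Real.norm_eq_abs,
      abs_of_nonneg (le_max_right t 0)]
    have hmax : max t 0 ≤ |t| := max_le (le_abs_self t) (abs_nonneg t)
    calc |t|⁻¹ * max t 0 ^ (n + 2) ≤ |t|⁻¹ * |t| ^ (n + 2) := by gcongr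
      _ = |t| ^ (n + 1) := by rw [pow_succ]; field_simp
  · rw [max_eq_left h.le]
    have := hasDerivAt_pow (n + 2) s
    push_cast at this
    refine this.congr_of_eventuallyEq ?_
    filter_upwards [lt_mem_nhds h] with y hy
    simp [max_eq_left hy.le]

/-- Grönwall's inequality in integral form with zero initial value. -/
lemma eq_zero_of_le_mul_integral {Y : ℝ → ℝ} {s C : ℝ} (hY : ContinuousOn Y (Icc 0 s))
    (hY0 : ∀ t ∈ Icc 0 s, 0 ≤ Y t)
    (h : ∀ t ∈ Icc 0 s, Y t ≤ C * ∫ r in (0 : ℝ)..t, Y r) : ∀ t ∈ Icc 0 s, Y t = 0 := by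
  intro t ht
  have hs : 0 ≤ s := ht.1.trans ht.2
  have hi : IntegrableOn Y (Icc 0 s) := hY.integrableOn_Icc
  have hii : ∀ x ∈ Icc 0 s, IntervalIntegrable Y volume 0 x := fun x hx =>
    (intervalIntegrable_iff_integrableOn_Icc_of_le hx.1).2 (hi.mono_set (Icc_subset_Icc_right hx.2))
  have hF0 : ∀ x ∈ Icc 0 s, 0 ≤ ∫ r in (0 : ℝ)..x, Y r := fun x hx =>
    intervalIntegral.integral_nonneg hx.1 fun r hr => hY0 r ⟨hr.1, hr.2.trans hx.2⟩
  have hcont : ContinuousOn (fun x => ∫ r in (0 : ℝ)..x, Y r) (Icc 0 s) := by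
    have := intervalIntegral.continuousOn_primitive_interval (a := 0) (b := s)
      (by rwa [uIcc_of_le hs] : IntegrableOn Y (uIcc 0 s))
    rwa [uIcc_of_le hs] at this
  have hder : ∀ x ∈ Ico 0 s,
      HasDerivWithinAt (fun x => ∫ r in (0 : ℝ)..x, Y r) (Y x) (Ici x) x := by
    intro x hx
    have hcx : ContinuousWithinAt Y (Ioi x) x := by
      refine (hY x (Ico_subset_Icc_self hx)).mono_of_mem_nhdsWithin ?_
      filter_upwards [Ioo_mem_nhdsGT hx.2] with y hy
      exact ⟨hx.1.trans hy.1.le, hy.2.le⟩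
    refine intervalIntegral.integral_hasDerivWithinAt_right (hii x (Ico_subset_Icc_self hx))
      (s := Ici x) (t := Ioi x) ?_ hcx
    refine ⟨Ioo x s, Ioo_mem_nhdsGT hx.2, ?_⟩
    refine (hY.mono fun y hy => ?_).aestronglyMeasurable measurableSet_Ioo
    exact ⟨hx.1.trans hy.1.le, hy.2.le⟩
  have hg := norm_le_gronwallBound_of_norm_deriv_right_le (δ := 0) (K := C) (ε := 0) hcont hder
    (by simp) (fun x hx => by
      have hx' := Ico_subset_Icc_self hx
      rw [Real.norm_of_nonneg (hY0 x hx'), Real.norm_of_nonneg (hF0 x hx'), add_zero]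
      exact h x hx') t ht
  rw [gronwallBound_ε0_δ0, norm_le_zero_iff] at hg
  have := h t ht
  rw [hg, mul_zero] at this
  exact le_antisymm this (hY0 t ht)

lemma HasWeakDeriv.sub {E : Type*} [NormedAddCommGroup E] [NormedSpace ℝ E] [MeasureSpace E]
    [BorelSpace E] {U : Set E} {f₁ f₂ h₁ h₂ : E → ℝ} {v : E}
    (w₁ : HasWeakDeriv U f₁ h₁ v) (w₂ : HasWeakDeriv U f₂ h₂ v)
    (hf₁ : IntegrableOn f₁ U) (hf₂ : IntegrableOn f₂ U) (hh₁ : IntegrableOn h₁ U)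
    (hh₂ : IntegrableOn h₂ U) : HasWeakDeriv U (fun x => f₁ x - f₂ x) (fun x => h₁ x - h₂ x) v := by
  intro φ hφ
  obtain ⟨C, hC⟩ := (hφ.hasCompactSupport_fderiv_apply v).exists_bound_of_continuous
    (hφ.continuous_fderiv_apply v)
  obtain ⟨C', hC'⟩ := hφ.2.1.exists_bound_of_continuous hφ.continuous
  have i1 : ∀ f, IntegrableOn f U → IntegrableOn (fun x => f x * fderiv ℝ φ x v) U := fun f hf =>
    hf.mul_bdd (c := C) (hφ.continuous_fderiv_apply v).aestronglyMeasurable (.of_forall hC)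
  have i2 : ∀ f, IntegrableOn f U → IntegrableOn (fun x => f x * φ x) U := fun f hf =>
    hf.mul_bdd (c := C') hφ.continuous.aestronglyMeasurable (.of_forall hC')
  simp only [sub_mul]
  rw [integral_sub (i1 _ hf₁) (i1 _ hf₂), integral_sub (i2 _ hh₁) (i2 _ hh₂), w₁ φ hφ, w₂ φ hφ]
  ring

/-! ### The comparison principle -/

instance isAddHaarMeasure_volume_prod :
    (volume : Measure (EuclideanSpace ℝ (Fin N) × ℝ)).IsAddHaarMeasure :=
  Measure.prod.instIsAddHaarMeasure _ _

lemma isFiniteMeasure_restrict (hb : Bornology.IsBounded Ω) :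
    IsFiniteMeasure (volume.restrict Ω) := ⟨by simpa using hb.measure_lt_top⟩

lemma isFiniteMeasure_restrict_cylinder (hb : Bornology.IsBounded Ω) (s : ℝ) :
    IsFiniteMeasure (volume.restrict (cylinder Ω s)) :=
  ⟨by simpa [cylinder] using (hb.prod (isBounded_Ioo 0 s)).measure_lt_top⟩

/-- Slices in time of a bounded measurable field are integrable. -/
lemma ae_integrableOn_slice (hb : Bornology.IsBounded Ω) {s M : ℝ} {F : Type*}
    [NormedAddCommGroup F] {f : EuclideanSpace ℝ (Fin N) × ℝ → F}
    (hf : AEStronglyMeasurable f (volume.restrict (cylinder Ω s)))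
    (hM : ∀ᵐ z ∂(volume.restrict (cylinder Ω s)), ‖f z‖ ≤ M) :
    ∀ᵐ t ∂(volume.restrict (Ioo 0 s)), IntegrableOn (fun x => f (x, t)) Ω := by
  have := isFiniteMeasure_restrict hb
  filter_upwards [ae_slice_aestronglyMeasurable hf, ae_slice hM] with t h1 h2
  exact Integrable.of_bound h1 M h2

lemma IsWeakGradient.hasWeakDeriv {f : EuclideanSpace ℝ (Fin N) → ℝ}
    {G : EuclideanSpace ℝ (Fin N) → EuclideanSpace ℝ (Fin N)} (h : IsWeakGradient Ω f G)
    (v : EuclideanSpace ℝ (Fin N)) : HasWeakDeriv Ω f (fun x => inner ℝ (G x) v) v :=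
  fun φ hφ => h.2.2 φ hφ v

lemma MemLpW1.exists_bound {s : ℝ} {u : EuclideanSpace ℝ (Fin N) × ℝ → ℝ}
    {Du : EuclideanSpace ℝ (Fin N) × ℝ → EuclideanSpace ℝ (Fin N)}
    (h : MemLpW1 Ω s ∞ u Du) :
    ∃ M, ∀ᵐ z ∂(volume.restrict (cylinder Ω s)), ‖Du z‖ ≤ M := by
  refine ⟨(eLpNorm Du ∞ (volume.restrict (cylinder Ω s))).toReal, ?_⟩
  have hfin := h.2.1.2
  rw [eLpNorm_exponent_top] at hfin ⊢
  filter_upwards [ae_le_eLpNormEssSup (f := Du) (μ := volume.restrict (cylinder Ω s))] with z hz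
  have := ENNReal.toReal_mono hfin.ne hz
  simpa using this

/-- The square of the positive part of the difference of a sub- and a supersolution is an
admissible test function. -/
lemma isAdmissible_sq_posPart (hΩ : IsOpen Ω) (hb : Bornology.IsBounded Ω) {p s : ℝ} (hs : 0 < s)
    {v u : EuclideanSpace ℝ (Fin N) × ℝ → ℝ}
    {Dv Du : EuclideanSpace ℝ (Fin N) × ℝ → EuclideanSpace ℝ (Fin N)}
    (hvc : ContinuousOn v (closure Ω ×ˢ Icc 0 s)) (huc : ContinuousOn u (closure Ω ×ˢ Icc 0 s))
    (hv : MemLpW1 Ω s ∞ v Dv) (hu : MemLpW1 Ω s ∞ u Du)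
    (hbd : ∀ x ∈ frontier Ω, ∀ t ∈ Ioo 0 s, v (x, t) ≤ u (x, t)) :
    IsAdmissible Ω p s (fun z => (max (v z - u z) 0) ^ 2)
      (fun z => (2 * max (v z - u z) 0) • (Dv z - Du z)) := by
  have hfin := isFiniteMeasure_restrict_cylinder hb s
  have hPc : ContinuousOn (fun z => max (v z - u z) 0) (closure Ω ×ˢ Icc 0 s) :=
    ContinuousOn.sup (hvc.sub huc) continuousOn_const
  have hsub : cylinder Ω s ⊆ closure Ω ×ˢ Icc 0 s := prod_mono subset_closure Ioo_subset_Icc_self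
  have hm := (isOpen_cylinder hΩ s).measurableSet
  obtain ⟨C, hC⟩ := (hb.isCompact_closure.prod isCompact_Icc).exists_bound_of_continuousOn hPc
  obtain ⟨M₁, hM₁⟩ := hv.exists_bound
  obtain ⟨M₂, hM₂⟩ := hu.exists_bound
  have hDm : AEStronglyMeasurable (fun z => (2 * max (v z - u z) 0) • (Dv z - Du z))
      (volume.restrict (cylinder Ω s)) :=
    (((hPc.mono hsub).aestronglyMeasurable hm).const_mul 2).smul
      (hv.2.1.aestronglyMeasurable.sub hu.2.1.aestronglyMeasurable)
  have hDb : ∀ᵐ z ∂(volume.restrict (cylinder Ω s)),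
      ‖(2 * max (v z - u z) 0) • (Dv z - Du z)‖ ≤ 2 * C * (M₁ + M₂) := by
    filter_upwards [hM₁, hM₂, ae_restrict_mem hm] with z h1 h2 hz
    have h3 := hC z (hsub hz)
    rw [norm_smul, norm_mul, Real.norm_ofNat]
    have h4 : ‖Dv z - Du z‖ ≤ M₁ + M₂ := (norm_sub_le _ _).trans (add_le_add h1 h2)
    exact mul_le_mul (mul_le_mul_of_nonneg_left h3 zero_le_two) h4 (norm_nonneg _)
      (mul_nonneg zero_le_two ((norm_nonneg _).trans h3))
  refine ⟨?_, ⟨?_, MemLp.of_bound hDm _ hDb, ?_⟩, fun z _ => by positivity, ?_⟩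
  · rw [cylinder, closure_prod_eq, closure_Ioo hs.ne]
    exact hPc.pow 2
  · refine MemLp.of_bound (((hPc.pow 2).mono hsub).aestronglyMeasurable hm) (C ^ 2) ?_
    filter_upwards [ae_restrict_mem hm] with z hz
    rw [norm_pow]
    exact pow_le_pow_left₀ (norm_nonneg _) (hC z (hsub hz)) 2
  · filter_upwards [hv.2.2, hu.2.2, ae_integrableOn_slice hb hv.2.1.aestronglyMeasurable hM₁,
      ae_integrableOn_slice hb hu.2.1.aestronglyMeasurable hM₂,
      ae_integrableOn_slice hb hDm hDb, ae_restrict_mem measurableSet_Ioo]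
      with t hvt hut hDv hDu hDψ ht
    have hslice : ∀ f : EuclideanSpace ℝ (Fin N) × ℝ → ℝ,
        ContinuousOn f (closure Ω ×ˢ Icc 0 s) →
        ContinuousOn (fun x => f (x, t)) (closure Ω) := fun f hf =>
      hf.comp (by fun_prop) fun x hx => ⟨hx, Ioo_subset_Icc_self ht⟩
    have hint : ∀ f : EuclideanSpace ℝ (Fin N) × ℝ → ℝ,
        ContinuousOn f (closure Ω ×ˢ Icc 0 s) → IntegrableOn (fun x => f (x, t)) Ω := fun f hf =>
      ((hslice f hf).integrableOn_compact hb.isCompact_closure).mono_set subset_closure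
    refine ⟨(hint _ (hPc.pow 2)).locallyIntegrableOn, hDψ.locallyIntegrableOn, fun φ hφ e => ?_⟩
    have hw := (hvt.hasWeakDeriv e).sub (hut.hasWeakDeriv e) (hint v hvc) (hint u huc)
      (hDv.inner_const e) (hDu.inner_const e)
    have hchain := hw.comp hΩ ((hslice _ (hvc.sub huc)).mono subset_closure)
      (hint _ (hvc.sub huc)) ((hDv.inner_const e).sub (hDu.inner_const e))
      (β := fun s => max s 0 ^ 2) (β' := fun s => 2 * max s 0)
      (fun s => by simpa using hasDerivAt_posPart_pow 0 s) (by fun_prop) φ hφ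
    rw [hchain]
    congr 1
    refine integral_congr_ae (.of_forall fun x => ?_)
    simp only [inner_smul_left, inner_sub_left, RCLike.conj_to_real]
  · intro x hx t ht
    simp [max_eq_right (sub_nonpos.2 (hbd x hx t ht))]

lemma norm_pow_mul_inner_le {V : Type*} [NormedAddCommGroup V] [InnerProductSpace ℝ V] {r M M' : ℝ}
    (hr : 0 ≤ r) {a b : V} (ha : ‖a‖ ≤ M) (hb : ‖b‖ ≤ M') :
    ‖‖a‖ ^ r * inner ℝ a b‖ ≤ M ^ r * (M * M') := by
  have hM : 0 ≤ M := (norm_nonneg a).trans ha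
  have h1 : ‖a‖ ^ r ≤ M ^ r := Real.rpow_le_rpow (norm_nonneg a) ha hr
  rw [norm_mul, Real.norm_of_nonneg (Real.rpow_nonneg (norm_nonneg a) r)]
  exact mul_le_mul h1 ((norm_inner_le_norm a b).trans (mul_le_mul ha hb (norm_nonneg b) hM))
    (norm_nonneg _) (Real.rpow_nonneg hM r)

/-- The energy inequality for the positive part of the difference of a sub- and a
supersolution. -/
lemma integral_cube_posPart_le (hΩ : IsOpen Ω) (hb : Bornology.IsBounded Ω) {p q s M : ℝ}
    (hp : 2 ≤ p) (hq : p ≤ 2 * q) (hs : 0 < s) {g u₀ : EuclideanSpace ℝ (Fin N) → ℝ}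
    {v u vt ut : EuclideanSpace ℝ (Fin N) × ℝ → ℝ}
    {Dv Du : EuclideanSpace ℝ (Fin N) × ℝ → EuclideanSpace ℝ (Fin N)}
    (hvc : ContinuousOn v (closure Ω ×ˢ Icc 0 s)) (huc : ContinuousOn u (closure Ω ×ˢ Icc 0 s))
    (hvL : MemLpW1 Ω s ∞ v Dv) (huL : MemLpW1 Ω s ∞ u Du)
    (hv : IsWeakSubsolution Ω p q g u₀ s v Dv vt)
    (hu : IsWeakSupersolution Ω p q g u₀ s u Du ut)
    (hMv : ∀ᵐ z ∂(volume.restrict (cylinder Ω s)), ‖Dv z‖ ≤ M) :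
    (∫ x in Ω, (max (v (x, s) - u (x, s)) 0) ^ 3) ≤
      3 * (q ^ 2 / 4 * M ^ (2 * q - p)) * ∫ z in cylinder Ω s, (max (v z - u z) 0) ^ 3 := by
  have hfin := isFiniteMeasure_restrict_cylinder hb s
  obtain ⟨Mu, hMu⟩ := huL.exists_bound
  have hPc : ContinuousOn (fun z => max (v z - u z) 0) (closure Ω ×ˢ Icc 0 s) :=
    ContinuousOn.sup (hvc.sub huc) continuousOn_const
  have hsub : cylinder Ω s ⊆ closure Ω ×ˢ Icc 0 s := prod_mono subset_closure Ioo_subset_Icc_self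
  have hm := (isOpen_cylinder hΩ s).measurableSet
  obtain ⟨C, hC⟩ := (hb.isCompact_closure.prod isCompact_Icc).exists_bound_of_continuousOn hPc
  have hψ := isAdmissible_sq_posPart (p := p) hΩ hb hs hvc huc hvL huL fun x hx t ht =>
    (hv.2.2.1 x hx t ht).trans (hu.2.2.1 x hx t ht)
  have hvψ := hv.2.2.2 _ _ hψ
  have huψ := hu.2.2.2 _ _ hψ
  -- integrability of all terms
  have hvt : IntegrableOn vt (cylinder Ω s) := hv.1.2.2.1.integrable one_le_two
  have hut : IntegrableOn ut (cylinder Ω s) := hu.1.2.2.1.integrable one_le_two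
  have hDvm := hvL.2.1.aestronglyMeasurable
  have hDum := huL.2.1.aestronglyMeasurable
  have hPm := (hPc.mono hsub).aestronglyMeasurable (μ := volume) hm
  have hPb : ∀ᵐ z ∂(volume.restrict (cylinder Ω s)), ‖max (v z - u z) 0‖ ≤ C := by
    filter_upwards [ae_restrict_mem hm] with z hz using hC z (hsub hz)
  have hP2b : ∀ᵐ z ∂(volume.restrict (cylinder Ω s)), ‖(max (v z - u z) 0) ^ 2‖ ≤ C ^ 2 := by
    filter_upwards [hPb] with z hz
    rw [norm_pow]
    exact pow_le_pow_left₀ (norm_nonneg _) hz 2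
  have hi_t : ∀ f : EuclideanSpace ℝ (Fin N) × ℝ → ℝ, IntegrableOn f (cylinder Ω s) →
      IntegrableOn (fun z => f z * (max (v z - u z) 0) ^ 2) (cylinder Ω s) := fun f hf =>
    hf.mul_bdd (c := C ^ 2) (hPm.pow 2) hP2b
  have hpow : ∀ (G : EuclideanSpace ℝ (Fin N) × ℝ → EuclideanSpace ℝ (Fin N)) (r : ℝ),
      AEStronglyMeasurable G (volume.restrict (cylinder Ω s)) →
      AEStronglyMeasurable (fun z => ‖G z‖ ^ r) (volume.restrict (cylinder Ω s)) :=
    fun G r hG => (hG.norm.aemeasurable.pow_const r).aestronglyMeasurable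
  have hi_q : ∀ (G : EuclideanSpace ℝ (Fin N) × ℝ → EuclideanSpace ℝ (Fin N)) (K : ℝ),
      AEStronglyMeasurable G (volume.restrict (cylinder Ω s)) →
      (∀ᵐ z ∂(volume.restrict (cylinder Ω s)), ‖G z‖ ≤ K) →
      IntegrableOn (fun z => ‖G z‖ ^ q * (max (v z - u z) 0) ^ 2) (cylinder Ω s) := by
    intro G K hG hK
    refine hi_t _ (Integrable.of_bound (hpow G q hG) (K ^ q) ?_)
    filter_upwards [hK] with z hz
    rw [Real.norm_of_nonneg (by positivity)]
    exact Real.rpow_le_rpow (norm_nonneg _) hz (by linarith)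
  have hDb : ∀ᵐ z ∂(volume.restrict (cylinder Ω s)),
      ‖(2 * max (v z - u z) 0) • (Dv z - Du z)‖ ≤ 2 * C * (M + Mu) := by
    filter_upwards [hMv, hMu, hPb] with z h1 h2 h3
    rw [norm_smul, norm_mul, Real.norm_ofNat]
    exact mul_le_mul (mul_le_mul_of_nonneg_left h3 zero_le_two)
      ((norm_sub_le _ _).trans (add_le_add h1 h2)) (norm_nonneg _)
      (mul_nonneg zero_le_two ((norm_nonneg _).trans h3))
  have hi_p : ∀ (G : EuclideanSpace ℝ (Fin N) × ℝ → EuclideanSpace ℝ (Fin N)) (K : ℝ),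
      AEStronglyMeasurable G (volume.restrict (cylinder Ω s)) →
      (∀ᵐ z ∂(volume.restrict (cylinder Ω s)), ‖G z‖ ≤ K) →
      IntegrableOn (fun z => ‖G z‖ ^ (p - 2) *
        inner ℝ (G z) ((2 * max (v z - u z) 0) • (Dv z - Du z))) (cylinder Ω s) := by
    intro G K hG hK
    refine Integrable.of_bound ((hpow G _ hG).mul
      (hG.inner ((hPm.const_mul 2).smul (hDvm.sub hDum))))
      (K ^ (p - 2) * (K * (2 * C * (M + Mu)))) ?_
    filter_upwards [hK, hDb] with z h1 h2
    exact norm_pow_mul_inner_le (by linarith) h1 h2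
  have hi3 : IntegrableOn (fun z => (max (v z - u z) 0) ^ 3) (cylinder Ω s) :=
    integrableOn_cylinder_of_continuousOn hb (hPc.pow 3)
  -- the time derivative of the energy
  have hvi := integrableOn_cylinder_of_continuousOn hb hvc
  have hui := integrableOn_cylinder_of_continuousOn hb huc
  have hwt : HasWeakDeriv (cylinder Ω s) (fun z => v z - u z) (fun z => vt z - ut z) (0, 1) :=
    HasWeakDeriv.sub (fun φ hφ => hv.1.2.2.2 φ hφ) (fun φ hφ => hu.1.2.2.2 φ hφ) hvi hui hvt hut
  have hchain := hwt.comp (isOpen_cylinder hΩ s) ((hvc.sub huc).mono hsub) (hvi.sub hui)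
    (hvt.sub hut) (β := fun s => max s 0 ^ 3) (β' := fun s => 3 * max s 0 ^ 2)
    (fun s => by
      have := hasDerivAt_posPart_pow 1 s
      norm_num at this
      exact this) (by fun_prop)
  have hbase : IntegrableOn (fun z => (vt z - ut z) * (max (v z - u z) 0) ^ 2) (cylinder Ω s) :=
    hi_t _ (hvt.sub hut)
  have htime := integral_weak_time_deriv hΩ hb hs (hPc.pow 3)
    ((hbase.const_mul 3).congr (.of_forall fun z => by simp only; ring)) hchain
  have h0 : ∫ x in Ω, (max (v (x, 0) - u (x, 0)) 0) ^ 3 = 0 := by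
    rw [setIntegral_congr_fun (g := fun _ => 0) hΩ.measurableSet, integral_zero]
    intro x hx
    have := (hv.2.1 x hx).trans (hu.2.1 x hx)
    simp [max_eq_right (sub_nonpos.2 this)]
  simp only [Pi.pow_apply] at htime
  rw [h0, sub_zero] at htime
  rw [← htime]
  have e1 : ∫ z in cylinder Ω s, 3 * max (v z - u z) 0 ^ 2 * (vt z - ut z) =
      3 * ∫ z in cylinder Ω s, (vt z - ut z) * max (v z - u z) 0 ^ 2 := by
    rw [← integral_const_mul]
    exact integral_congr_ae (.of_forall fun z => by simp only; ring)
  rw [e1, mul_assoc]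
  refine mul_le_mul_of_nonneg_left ?_ (by norm_num)
  rw [integral_add (hi_t _ hvt) (hi_p Dv M hDvm hMv)] at hvψ
  rw [integral_add (hi_t _ hut) (hi_p Du Mu hDum hMu)] at huψ
  have e2 : ∫ z in cylinder Ω s, (vt z - ut z) * max (v z - u z) 0 ^ 2 =
      (∫ z in cylinder Ω s, vt z * max (v z - u z) 0 ^ 2) -
        ∫ z in cylinder Ω s, ut z * max (v z - u z) 0 ^ 2 := by
    rw [← integral_sub (hi_t _ hvt) (hi_t _ hut)]
    exact integral_congr_ae (.of_forall fun z => by simp only; ring)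
  have e3 := integral_mono_ae
    (((hi_q Dv M hDvm hMv).sub (hi_q Du Mu hDum hMu)).sub
      ((hi_p Dv M hDvm hMv).sub (hi_p Du Mu hDum hMu)))
    (hi3.const_mul (q ^ 2 / 4 * M ^ (2 * q - p))) (by
      filter_upwards [hMv] with z hz
      have := source_sub_diffusion_le hp hq (b := Du z) hz (le_max_right (v z - u z) 0)
      rw [sub_mul] at this
      exact this)
  rw [integral_sub' ((hi_q Dv M hDvm hMv).sub (hi_q Du Mu hDum hMu))
      ((hi_p Dv M hDvm hMv).sub (hi_p Du Mu hDum hMu)),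
    integral_sub' (hi_q Dv M hDvm hMv) (hi_q Du Mu hDum hMu),
    integral_sub' (hi_p Dv M hDvm hMv) (hi_p Du Mu hDum hMu), integral_const_mul] at e3
  rw [e2]
  linarith

/-- The comparison principle for sub- and supersolutions that are Lipschitz in space. -/
theorem comparison_principle (hΩ : IsOpen Ω) (hb : Bornology.IsBounded Ω) {p q : ℝ}
    (hp : 2 ≤ p) (hq : p ≤ 2 * q) {S : ℝ} {g u₀ : EuclideanSpace ℝ (Fin N) → ℝ}
    {v u vt ut : EuclideanSpace ℝ (Fin N) × ℝ → ℝ}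
    {Dv Du : EuclideanSpace ℝ (Fin N) × ℝ → EuclideanSpace ℝ (Fin N)}
    (hvL : ∀ s ∈ Ioo 0 S, MemLpW1 Ω s ∞ v Dv) (huL : ∀ s ∈ Ioo 0 S, MemLpW1 Ω s ∞ u Du)
    (hv : ∀ s ∈ Ioo 0 S, IsWeakSubsolution Ω p q g u₀ s v Dv vt)
    (hu : ∀ s ∈ Ioo 0 S, IsWeakSupersolution Ω p q g u₀ s u Du ut) :
    ∀ x ∈ Ω, ∀ t ∈ Ioo 0 S, v (x, t) ≤ u (x, t) := by
  intro x hx t ht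
  obtain ⟨S', htS, hS'⟩ := exists_between ht.2
  have hS'0 : S' ∈ Ioo 0 S := ⟨ht.1.trans htS, hS'⟩
  have hcl : ∀ r ≤ t, closure Ω ×ˢ Icc 0 r ⊆ closure Ω ×ˢ Ico 0 S' := fun r hr =>
    prod_mono subset_rfl fun y hy => ⟨hy.1, (hy.2.trans hr).trans_lt htS⟩
  have hvc : ∀ r ≤ t, ContinuousOn v (closure Ω ×ˢ Icc 0 r) := fun r hr =>
    (hv S' hS'0).1.1.mono (hcl r hr)
  have huc : ∀ r ≤ t, ContinuousOn u (closure Ω ×ˢ Icc 0 r) := fun r hr =>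
    (hu S' hS'0).1.1.mono (hcl r hr)
  obtain ⟨M, hM⟩ := (hvL t ht).exists_bound
  have hPc : ContinuousOn (fun z => (max (v z - u z) 0) ^ 3) (closure Ω ×ˢ Icc 0 t) :=
    (ContinuousOn.sup ((hvc t le_rfl).sub (huc t le_rfl)) continuousOn_const).pow 3
  have hY := continuousOn_integral_slice hb hΩ hPc
  have hY0 : ∀ r ∈ Icc 0 t, 0 ≤ ∫ x in Ω, (max (v (x, r) - u (x, r)) 0) ^ 3 := fun r _ =>
    integral_nonneg fun x => by positivity
  have hbound : ∀ r ∈ Icc 0 t, (∫ x in Ω, (max (v (x, r) - u (x, r)) 0) ^ 3) ≤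
      3 * (q ^ 2 / 4 * M ^ (2 * q - p)) *
        ∫ τ in (0 : ℝ)..r, ∫ x in Ω, (max (v (x, τ) - u (x, τ)) 0) ^ 3 := by
    intro r hr
    rcases hr.1.eq_or_lt with h0 | h0
    · subst h0
      rw [intervalIntegral.integral_same, mul_zero,
        setIntegral_congr_fun (g := fun _ => 0) hΩ.measurableSet, integral_zero]
      intro x hx
      have := ((hv t ht).2.1 x hx).trans ((hu t ht).2.1 x hx)
      simp [max_eq_right (sub_nonpos.2 this)]
    · have hrS : r ∈ Ioo 0 S := ⟨h0, hr.2.trans_lt ht.2⟩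
      have hsub : cylinder Ω r ⊆ cylinder Ω t := prod_mono subset_rfl (Ioo_subset_Ioo_right hr.2)
      have h1 := integral_cube_posPart_le hΩ hb hp hq h0 (hvc r hr.2) (huc r hr.2) (hvL r hrS)
        (huL r hrS) (hv r hrS) (hu r hrS) (ae_mono (Measure.restrict_mono_set _ hsub) hM)
      rw [integral_cylinder (integrableOn_cylinder_of_continuousOn hb
        (hPc.mono (prod_mono subset_rfl (Icc_subset_Icc_right hr.2))))] at h1
      rwa [intervalIntegral.integral_of_le h0.le, integral_Ioc_eq_integral_Ioo]
  have hzero := eq_zero_of_le_mul_integral hY hY0 hbound t (right_mem_Icc.2 ht.1.le)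
  have hsl : ContinuousOn (fun x => (max (v (x, t) - u (x, t)) 0) ^ 3) (closure Ω) :=
    hPc.comp (by fun_prop) fun y hy => ⟨hy, right_mem_Icc.2 ht.1.le⟩
  have hsi : IntegrableOn (fun x => (max (v (x, t) - u (x, t)) 0) ^ 3) Ω :=
    (hsl.integrableOn_compact hb.isCompact_closure).mono_set subset_closure
  rw [setIntegral_eq_zero_iff_of_nonneg_ae (.of_forall fun x => by positivity) hsi] at hzero
  have heq := Measure.eqOn_open_of_ae_eq hzero hΩ (hsl.mono subset_closure) continuousOn_const
  have h1 := heq hx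
  simp only [Pi.zero_apply, ne_eq, OfNat.ofNat_ne_zero, not_false_eq_true, pow_eq_zero_iff,
    max_eq_right_iff, tsub_le_iff_right, zero_add] at h1
  exact h1

/-! ### Invariance under scaling -/

/-- The dilation `(x, t) ↦ (x, κ t)` of the time variable. -/
def timeDilation (κ : ℝ) (z : EuclideanSpace ℝ (Fin N) × ℝ) : EuclideanSpace ℝ (Fin N) × ℝ :=
  (z.1, κ * z.2)

lemma contDiff_timeDilation (κ : ℝ) : ContDiff ℝ ∞ (timeDilation (N := N) κ) :=
  contDiff_fst.prodMk (contDiff_const.mul contDiff_snd)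

lemma continuous_timeDilation (κ : ℝ) : Continuous (timeDilation (N := N) κ) :=
  (contDiff_timeDilation κ).continuous

lemma timeDilation_timeDilation {κ κ' : ℝ} (h : κ * κ' = 1)
    (z : EuclideanSpace ℝ (Fin N) × ℝ) : timeDilation κ (timeDilation κ' z) = z := by
  simp [timeDilation, ← mul_assoc, h]

lemma timeDilation_mem_prod_Ioo {κ : ℝ} (hκ : 0 < κ) (A : Set (EuclideanSpace ℝ (Fin N))) (s : ℝ)
    (z : EuclideanSpace ℝ (Fin N) × ℝ) :
    timeDilation κ z ∈ A ×ˢ Ioo 0 (κ * s) ↔ z ∈ A ×ˢ Ioo 0 s := by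
  simp [timeDilation, hκ]

lemma measurableEmbedding_timeDilation {κ : ℝ} (hκ : 0 < κ) :
    MeasurableEmbedding (timeDilation (N := N) κ) := by
  let e : (EuclideanSpace ℝ (Fin N) × ℝ) ≃ₜ (EuclideanSpace ℝ (Fin N) × ℝ) :=
    { toFun := timeDilation κ
      invFun := timeDilation κ⁻¹
      left_inv := timeDilation_timeDilation (inv_mul_cancel₀ hκ.ne')
      right_inv := timeDilation_timeDilation (mul_inv_cancel₀ hκ.ne')
      continuous_toFun := continuous_timeDilation κ
      continuous_invFun := continuous_timeDilation κ⁻¹ }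
  exact e.measurableEmbedding

lemma map_timeDilation {κ : ℝ} (hκ : 0 < κ) (Ω : Set (EuclideanSpace ℝ (Fin N))) (s : ℝ) :
    Measure.map (timeDilation κ) (volume.restrict (cylinder Ω s)) =
      ENNReal.ofReal κ⁻¹ • volume.restrict (cylinder Ω (κ * s)) := by
  have h1 : Measure.map (timeDilation κ) (volume : Measure (EuclideanSpace ℝ (Fin N) × ℝ)) =
      ENNReal.ofReal κ⁻¹ • volume := by
    have := Measure.map_prod_map (volume : Measure (EuclideanSpace ℝ (Fin N)))
      (volume : Measure ℝ) measurable_id (measurable_const_mul κ)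
    rw [Measure.map_id, Real.map_volume_mul_left hκ.ne', Measure.prod_smul_right,
      abs_of_pos (inv_pos.2 hκ)] at this
    exact this.symm
  rw [← Measure.restrict_smul, ← h1, (measurableEmbedding_timeDilation hκ).restrict_map]
  congr 2
  ext z
  exact (timeDilation_mem_prod_Ioo hκ Ω s z).symm

lemma integral_comp_timeDilation {κ : ℝ} (hκ : 0 < κ) (s : ℝ)
    (F : EuclideanSpace ℝ (Fin N) × ℝ → ℝ) :
    ∫ z in cylinder Ω s, F (timeDilation κ z) = κ⁻¹ * ∫ z in cylinder Ω (κ * s), F z := by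
  rw [← (measurableEmbedding_timeDilation hκ).integral_map, map_timeDilation hκ,
    integral_smul_measure, ENNReal.toReal_ofReal (inv_pos.2 hκ).le, smul_eq_mul]

lemma MemLp.comp_timeDilation {F : Type*} [NormedAddCommGroup F] {κ : ℝ} (hκ : 0 < κ) {s : ℝ}
    {r : ℝ≥0∞} {f : EuclideanSpace ℝ (Fin N) × ℝ → F}
    (h : MemLp f r (volume.restrict (cylinder Ω (κ * s)))) :
    MemLp (fun z => f (timeDilation κ z)) r (volume.restrict (cylinder Ω s)) := by
  have := h.smul_measure (c := ENNReal.ofReal κ⁻¹) ENNReal.ofReal_ne_top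
  rw [← map_timeDilation hκ] at this
  exact (measurableEmbedding_timeDilation hκ).memLp_map_measure_iff.1 this

lemma MemLpW1.comp_timeDilation {κ : ℝ} (hκ : 0 < κ) {s : ℝ} {r : ℝ≥0∞}
    {u : EuclideanSpace ℝ (Fin N) × ℝ → ℝ}
    {Du : EuclideanSpace ℝ (Fin N) × ℝ → EuclideanSpace ℝ (Fin N)}
    (h : MemLpW1 Ω (κ * s) r u Du) :
    MemLpW1 Ω s r (fun z => u (timeDilation κ z)) (fun z => Du (timeDilation κ z)) := by
  refine ⟨MemLp.comp_timeDilation hκ h.1, MemLp.comp_timeDilation hκ h.2.1, ?_⟩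
  have h3 := h.2.2
  rw [ae_restrict_iff' measurableSet_Ioo] at h3 ⊢
  have hq : Measure.QuasiMeasurePreserving (fun t : ℝ => κ * t) volume volume := by
    refine ⟨measurable_const_mul κ, ?_⟩
    rw [Real.map_volume_mul_left hκ.ne']
    exact Measure.smul_absolutelyContinuous
  filter_upwards [hq.ae h3] with t ht hts
  exact ht ⟨mul_pos hκ hts.1, mul_lt_mul_of_pos_left hts.2 hκ⟩

lemma integral_fderiv_testFunction {E : Type*} [NormedAddCommGroup E] [NormedSpace ℝ E]
    [FiniteDimensional ℝ E] [MeasureSpace E] [BorelSpace E]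
    [(volume : Measure E).IsAddHaarMeasure] {U : Set E} {φ : E → ℝ} (hφ : IsTestFunction U φ)
    (v : E) : ∫ x in U, fderiv ℝ φ x v = 0 := by
  have h := ContDiff.hasWeakDeriv (contDiff_const (c := (1 : ℝ))) (U := U) v φ hφ
  simpa using h

/-- Affine changes `f ↦ l f - c` act on weak gradients by multiplication with `l`. -/
lemma IsWeakGradient.affine (hb : Bornology.IsBounded Ω)
    {f : EuclideanSpace ℝ (Fin N) → ℝ} {G : EuclideanSpace ℝ (Fin N) → EuclideanSpace ℝ (Fin N)}
    (h : IsWeakGradient Ω f G) (hfi : IntegrableOn f Ω) (l c : ℝ) :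
    IsWeakGradient Ω (fun x => l * f x - c) (fun x => l • G x) := by
  have := isFiniteMeasure_restrict hb
  have hi : IntegrableOn (fun x => l * f x - c) Ω := (hfi.const_mul l).sub (integrable_const c)
  refine ⟨hi.locallyIntegrableOn, h.2.1.smul l, fun φ hφ v => ?_⟩
  obtain ⟨C, hC⟩ := (hφ.hasCompactSupport_fderiv_apply v).exists_bound_of_continuous
    (hφ.continuous_fderiv_apply v)
  have hm : AEStronglyMeasurable (fun x => fderiv ℝ φ x v) (volume.restrict Ω) :=
    (hφ.continuous_fderiv_apply v).aestronglyMeasurable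
  simp only [sub_mul, inner_smul_left, RCLike.conj_to_real]
  rw [integral_sub ((hfi.const_mul l).mul_bdd hm (.of_forall hC))
    ((integrable_const c).mul_bdd hm (.of_forall hC)), integral_const_mul c,
    integral_fderiv_testFunction hφ, mul_zero, sub_zero]
  simp only [mul_assoc, integral_const_mul]
  rw [h.2.2 φ hφ v, mul_neg]

lemma MemLpW1.affine (hb : Bornology.IsBounded Ω) {s : ℝ} {r : ℝ≥0∞} (hr : 1 ≤ r)
    {u : EuclideanSpace ℝ (Fin N) × ℝ → ℝ}
    {Du : EuclideanSpace ℝ (Fin N) × ℝ → EuclideanSpace ℝ (Fin N)}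
    (h : MemLpW1 Ω s r u Du) (l c : ℝ) :
    MemLpW1 Ω s r (fun z => l * u z - c) (fun z => l • Du z) := by
  have := isFiniteMeasure_restrict_cylinder hb s
  refine ⟨(h.1.const_mul l).sub (memLp_const c), h.2.1.const_smul l, ?_⟩
  have hi : Integrable u ((volume.restrict Ω).prod (volume.restrict (Ioo 0 s))) := by
    rw [← restrict_cylinder]; exact h.1.integrable hr
  filter_upwards [h.2.2, hi.prod_left_ae] with t ht hti
  exact ht.affine hb hti l c

lemma IsTestFunction.comp_timeDilation {κ κ' : ℝ} (hκ : 0 < κ) (hκκ' : κ * κ' = 1) {s : ℝ}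
    {φ : EuclideanSpace ℝ (Fin N) × ℝ → ℝ} (h : IsTestFunction (cylinder Ω (κ * s)) φ) :
    IsTestFunction (cylinder Ω s) (fun z => φ (timeDilation κ z)) := by
  have hκ' : κ' * κ = 1 := by rw [mul_comm]; exact hκκ'
  have hsub : tsupport (fun z => φ (timeDilation κ z)) ⊆ timeDilation κ' '' tsupport φ := by
    refine closure_minimal (fun z hz => ?_) (h.2.1.image (continuous_timeDilation κ')).isClosed
    exact ⟨timeDilation κ z, subset_tsupport _ hz, timeDilation_timeDilation hκ' z⟩
  refine ⟨h.1.comp (contDiff_timeDilation κ), (h.2.1.image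
    (continuous_timeDilation κ')).of_isClosed_subset (isClosed_tsupport _) hsub, fun z hz => ?_⟩
  obtain ⟨y, hy, rfl⟩ := hsub hz
  rw [cylinder, ← timeDilation_mem_prod_Ioo hκ, timeDilation_timeDilation hκκ']
  exact h.2.2 hy

lemma fderiv_comp_timeDilation {κ : ℝ} {φ : EuclideanSpace ℝ (Fin N) × ℝ → ℝ}
    (hφ : Differentiable ℝ φ) (z : EuclideanSpace ℝ (Fin N) × ℝ) :
    fderiv ℝ (fun z => φ (timeDilation κ z)) z (0, 1) =
      κ * fderiv ℝ φ (timeDilation κ z) (0, 1) := by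
  have h0 : HasFDerivAt (fun z : EuclideanSpace ℝ (Fin N) × ℝ => z.2)
      (ContinuousLinearMap.snd ℝ (EuclideanSpace ℝ (Fin N)) ℝ) z := hasFDerivAt_snd
  have h1 : HasFDerivAt (timeDilation (N := N) κ) _ z :=
    hasFDerivAt_fst.prodMk (h0.const_mul κ)
  have h2 := (hφ (timeDilation κ z)).hasFDerivAt.comp z h1
  have h3 : fderiv ℝ (fun z => φ (timeDilation κ z)) z = _ := h2.fderiv
  rw [h3]
  have : ((0 : EuclideanSpace ℝ (Fin N)), κ) = κ • ((0 : EuclideanSpace ℝ (Fin N)), (1 : ℝ)) := by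
    simp
  simp only [ContinuousLinearMap.comp_apply, ContinuousLinearMap.prod_apply,
    ContinuousLinearMap.coe_fst', _root_.smul_apply, ContinuousLinearMap.coe_snd',
    smul_eq_mul, mul_one]
  rw [this, map_smul, smul_eq_mul]

lemma HasL2TimeDeriv.comp_timeDilation {κ : ℝ} (hκ : 0 < κ) {s : ℝ}
    {u ut : EuclideanSpace ℝ (Fin N) × ℝ → ℝ} (h : HasL2TimeDeriv Ω (κ * s) u ut) :
    HasL2TimeDeriv Ω s (fun z => u (timeDilation κ z)) (fun z => κ * ut (timeDilation κ z)) := by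
  refine ⟨(MemLp.comp_timeDilation hκ h.1).const_mul κ, fun φ hφ => ?_⟩
  have hinv : κ⁻¹ * κ = 1 := inv_mul_cancel₀ hκ.ne'
  have hs : κ⁻¹ * (κ * s) = s := by rw [← mul_assoc, hinv, one_mul]
  have hφ' : IsTestFunction (cylinder Ω (κ * s)) (fun z => φ (timeDilation κ⁻¹ z)) :=
    IsTestFunction.comp_timeDilation (inv_pos.2 hκ) hinv (by rwa [hs])
  have h1 := h.2 _ hφ'
  have hdiff : Differentiable ℝ φ := hφ.1.differentiable (by simp)
  simp only [fderiv_comp_timeDilation hdiff] at h1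
  have hz : ∀ z : EuclideanSpace ℝ (Fin N) × ℝ, timeDilation κ⁻¹ (timeDilation κ z) = z :=
    timeDilation_timeDilation hinv
  have e1 := integral_comp_timeDilation (Ω := Ω) hκ s
    (fun z => u z * (κ⁻¹ * fderiv ℝ φ (timeDilation κ⁻¹ z) (0, 1)))
  have e2 := integral_comp_timeDilation (Ω := Ω) hκ s (fun z => ut z * φ (timeDilation κ⁻¹ z))
  simp only [hz] at e1 e2
  rw [h1] at e1
  have e3 : ∀ z : EuclideanSpace ℝ (Fin N) × ℝ, u (timeDilation κ z) *
      (κ⁻¹ * fderiv ℝ φ z (0, 1)) = κ⁻¹ * (u (timeDilation κ z) * fderiv ℝ φ z (0, 1)) :=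
    fun z => by ring
  simp only [e3, integral_const_mul] at e1
  simp only [mul_assoc, integral_const_mul]
  rw [e2]
  field_simp at e1 ⊢
  exact e1

lemma HasL2TimeDeriv.affine (hb : Bornology.IsBounded Ω) {s : ℝ}
    {u ut : EuclideanSpace ℝ (Fin N) × ℝ → ℝ} (h : HasL2TimeDeriv Ω s u ut)
    (hu : IntegrableOn u (cylinder Ω s)) (l c : ℝ) :
    HasL2TimeDeriv Ω s (fun z => l * u z - c) (fun z => l * ut z) := by
  have := isFiniteMeasure_restrict_cylinder hb s
  refine ⟨h.1.const_mul l, fun φ hφ => ?_⟩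
  obtain ⟨C, hC⟩ := (hφ.hasCompactSupport_fderiv_apply (0, 1)).exists_bound_of_continuous
    (hφ.continuous_fderiv_apply (0, 1))
  have hm : AEStronglyMeasurable (fun x => fderiv ℝ φ x (0, 1)) (volume.restrict (cylinder Ω s)) :=
    (hφ.continuous_fderiv_apply (0, 1)).aestronglyMeasurable
  simp only [sub_mul]
  rw [integral_sub ((hu.const_mul l).mul_bdd hm (.of_forall hC))
    ((integrable_const c).mul_bdd hm (.of_forall hC)), integral_const_mul c,
    integral_fderiv_testFunction hφ, mul_zero, sub_zero]
  simp only [mul_assoc, integral_const_mul]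
  rw [h.2 φ hφ, mul_neg]

lemma IsAdmissible.comp_timeDilation {κ : ℝ} (hκ : 0 < κ) {p s : ℝ} (hs : 0 < s)
    {ψ : EuclideanSpace ℝ (Fin N) × ℝ → ℝ}
    {Dψ : EuclideanSpace ℝ (Fin N) × ℝ → EuclideanSpace ℝ (Fin N)}
    (h : IsAdmissible Ω p (κ * s) ψ Dψ) :
    IsAdmissible Ω p s (fun z => ψ (timeDilation κ z)) (fun z => Dψ (timeDilation κ z)) := by
  refine ⟨?_, h.2.1.comp_timeDilation hκ, fun z hz => h.2.2.1 _
    ((timeDilation_mem_prod_Ioo hκ Ω s z).2 hz), fun x hx t ht => h.2.2.2 x hx _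
    ⟨mul_pos hκ ht.1, mul_lt_mul_of_pos_left ht.2 hκ⟩⟩
  have hc := h.1
  rw [cylinder, closure_prod_eq, closure_Ioo (mul_pos hκ hs).ne] at hc
  rw [cylinder, closure_prod_eq, closure_Ioo hs.ne]
  exact hc.comp (continuous_timeDilation κ).continuousOn fun z hz =>
    ⟨hz.1, mul_nonneg hκ.le hz.2.1, mul_le_mul_of_nonneg_left hz.2.2 hκ.le⟩

/-- The scaling behind the theorem: if `u` is a subsolution and `l ≥ 1`, then so is
`l u(x, l^(p-2) t) - c`. The diffusion is invariant under this change, while the source term is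
multiplied by `l^(p-1-q) ≤ 1`. -/
lemma IsWeakSubsolution.rescale (hΩ : IsOpen Ω) (hb : Bornology.IsBounded Ω) {p q s l c : ℝ}
    (hp : 2 ≤ p) (hq : p - 1 ≤ q) (hs : 0 < s) (hl : 1 ≤ l) {g u₀ : EuclideanSpace ℝ (Fin N) → ℝ}
    {u ut : EuclideanSpace ℝ (Fin N) × ℝ → ℝ}
    {Du : EuclideanSpace ℝ (Fin N) × ℝ → EuclideanSpace ℝ (Fin N)}
    (h : IsWeakSubsolution Ω p q g u₀ (l ^ (p - 2) * s) u Du ut)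
    (hc₀ : ∀ x ∈ Ω, l * u₀ x - c ≤ u₀ x) (hc : ∀ x ∈ frontier Ω, l * g x - c ≤ g x) :
    IsWeakSubsolution Ω p q g u₀ s (fun z => l * u (timeDilation (l ^ (p - 2)) z) - c)
      (fun z => l • Du (timeDilation (l ^ (p - 2)) z))
      (fun z => l * (l ^ (p - 2) * ut (timeDilation (l ^ (p - 2)) z))) := by
  have hl0 : 0 < l := by linarith
  obtain ⟨κ, hκe⟩ : ∃ κ, κ = l ^ (p - 2) := ⟨_, rfl⟩
  have hκ : 0 < κ := hκe ▸ Real.rpow_pos_of_pos hl0 _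
  rw [← hκe] at h ⊢
  have hfin := isFiniteMeasure_restrict_cylinder hb s
  have hm1 : 1 ≤ ENNReal.ofReal (max p q) := by
    rw [ENNReal.one_le_ofReal]
    exact le_max_of_le_left (by linarith)
  have hW := h.1.2.1.comp_timeDilation hκ
  refine ⟨⟨?_, hW.affine hb hm1 l c,
    (h.1.2.2.comp_timeDilation hκ).affine hb (hW.1.integrable hm1) l c⟩, ?_, ?_, ?_⟩
  · refine (continuousOn_const.mul (h.1.1.comp (continuous_timeDilation κ).continuousOn
      fun z hz => ?_)).sub continuousOn_const
    exact ⟨hz.1, mul_nonneg hκ.le hz.2.1, mul_lt_mul_of_pos_left hz.2.2 hκ⟩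
  · intro x hx
    have h1 := h.2.1 x hx
    have h2 := mul_le_mul_of_nonneg_left h1 hl0.le
    have h3 := hc₀ x hx
    simp only [timeDilation, mul_zero]
    linarith
  · intro x hx t ht
    have h1 := h.2.2.1 x hx (κ * t) ⟨mul_pos hκ ht.1, mul_lt_mul_of_pos_left ht.2 hκ⟩
    have h2 := mul_le_mul_of_nonneg_left h1 hl0.le
    have h3 := hc x hx
    simp only [timeDilation]
    linarith
  · intro ψ Dψ hψ
    have hinv : κ⁻¹ * κ = 1 := inv_mul_cancel₀ hκ.ne'
    have hse : κ⁻¹ * (κ * s) = s := by rw [← mul_assoc, hinv, one_mul]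
    have hψ' : IsAdmissible Ω p (κ * s) (fun z => ψ (timeDilation κ⁻¹ z))
        (fun z => Dψ (timeDilation κ⁻¹ z)) :=
      IsAdmissible.comp_timeDilation (inv_pos.2 hκ) (mul_pos hκ hs) (by rwa [hse])
    have h1 := h.2.2.2 _ _ hψ'
    have hz : ∀ z : EuclideanSpace ℝ (Fin N) × ℝ, timeDilation κ⁻¹ (timeDilation κ z) = z :=
      timeDilation_timeDilation hinv
    have e1 := integral_comp_timeDilation (Ω := Ω) hκ s (fun z => ut z * ψ (timeDilation κ⁻¹ z) +
      ‖Du z‖ ^ (p - 2) * inner ℝ (Du z) (Dψ (timeDilation κ⁻¹ z)))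
    have e2 := integral_comp_timeDilation (Ω := Ω) hκ s
      (fun z => ‖Du z‖ ^ q * ψ (timeDilation κ⁻¹ z))
    simp only [hz] at e1 e2
    have h2 : ∫ z in cylinder Ω s, (ut (timeDilation κ z) * ψ z + ‖Du (timeDilation κ z)‖ ^ (p - 2)
        * inner ℝ (Du (timeDilation κ z)) (Dψ z)) ≤
        ∫ z in cylinder Ω s, ‖Du (timeDilation κ z)‖ ^ q * ψ z := by
      rw [e1, e2]
      exact mul_le_mul_of_nonneg_left h1 (inv_pos.2 hκ).le
    have hX : 0 ≤ ∫ z in cylinder Ω s, ‖Du (timeDilation κ z)‖ ^ q * ψ z := by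
      refine setIntegral_nonneg (isOpen_cylinder hΩ s).measurableSet fun z hz' => ?_
      have h3 := hψ.2.2.1 z hz'
      positivity
    have hlk : l * κ = l ^ (p - 1) := by
      rw [hκe, mul_comm, ← Real.rpow_add_one hl0.ne']
      congr 1; ring
    calc _ = l ^ (p - 1) * ∫ z in cylinder Ω s, (ut (timeDilation κ z) * ψ z +
          ‖Du (timeDilation κ z)‖ ^ (p - 2) * inner ℝ (Du (timeDilation κ z)) (Dψ z)) := by
          rw [← integral_const_mul]
          refine integral_congr_ae (.of_forall fun z => ?_)
          simp only [norm_smul, inner_smul_left, RCLike.conj_to_real]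
          rw [Real.norm_of_nonneg hl0.le, Real.mul_rpow hl0.le (norm_nonneg _), ← hκe, ← hlk]
          ring
      _ ≤ l ^ (p - 1) * ∫ z in cylinder Ω s, ‖Du (timeDilation κ z)‖ ^ q * ψ z :=
          mul_le_mul_of_nonneg_left h2 (by positivity)
      _ ≤ l ^ q * ∫ z in cylinder Ω s, ‖Du (timeDilation κ z)‖ ^ q * ψ z :=
          mul_le_mul_of_nonneg_right (Real.rpow_le_rpow_of_exponent_le hl hq) hX
      _ = _ := by
          rw [← integral_const_mul]
          refine integral_congr_ae (.of_forall fun z => ?_)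
          simp only [norm_smul]
          rw [Real.norm_of_nonneg hl0.le, Real.mul_rpow hl0.le (norm_nonneg _)]
          ring

/-- The zero function is a subsolution for nonnegative data. -/
lemma isWeakSubsolution_zero {p q s : ℝ} (hq : 0 < q)
    {g u₀ : EuclideanSpace ℝ (Fin N) → ℝ}
    (hu₀ : ∀ x ∈ Ω, 0 ≤ u₀ x) (hg : ∀ x ∈ frontier Ω, 0 ≤ g x) :
    IsWeakSubsolution Ω p q g u₀ s (fun _ => 0) (fun _ => 0) (fun _ => 0) := by
  refine ⟨⟨continuousOn_const, ⟨MemLp.zero', MemLp.zero', ?_⟩, MemLp.zero', ?_⟩, hu₀,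
    fun x hx _ _ => hg x hx, ?_⟩
  · refine .of_forall fun t => ⟨?_, ?_, fun φ _ v => by simp⟩ <;>
    exact (locallyIntegrable_zero).locallyIntegrableOn _
  · intro φ _
    simp
  · intro ψ Dψ _
    simp [Real.zero_rpow hq.ne']

/-! ### Growth in time and the bound on the time derivative -/

lemma mollify_sub_le {E : Type*} [NormedAddCommGroup E] [NormedSpace ℝ E] [FiniteDimensional ℝ E]
    [MeasureSpace E] [BorelSpace E] [(volume : Measure E).IsAddHaarMeasure]
    (ρ : ContDiffBump (0 : E)) {f : E → ℝ} (hf : LocallyIntegrable f) {x x' : E} {C : ℝ}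
    (h : ∀ y ∈ ball (0 : E) ρ.rOut, f (x' - y) - f (x - y) ≤ C) :
    mollify ρ f x' - mollify ρ f x ≤ C := by
  have hi : ∀ x, Integrable fun y => ρ.normed volume y * f (x - y) := fun x => by
    have := (ρ.hasCompactSupport_normed (μ := (volume : Measure E))).convolutionExists_left
      (L := ContinuousLinearMap.lsmul ℝ ℝ) (μ := volume) ρ.continuous_normed hf x
    simpa [ConvolutionExistsAt] using this
  rw [mollify_apply', mollify_apply', ← integral_sub (hi x') (hi x)]
  calc ∫ y, ρ.normed volume y * f (x' - y) - ρ.normed volume y * f (x - y)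
      ≤ ∫ y, ρ.normed volume y * C := by
        refine integral_mono ((hi x').sub (hi x)) (ρ.integrable_normed.mul_const C) fun y => ?_
        simp only
        rw [← mul_sub]
        by_cases hy : y ∈ ball (0 : E) ρ.rOut
        · exact mul_le_mul_of_nonneg_left (h y hy) (ρ.nonneg_normed y)
        · rw [← ρ.support_normed_eq (μ := volume), Function.notMem_support] at hy
          simp [hy]
    _ = C := by rw [integral_mul_const, ρ.integral_normed, one_mul]

/-- If increments of `f` to the right of `0` are at most those of `G`, so is the derivative. -/
lemma deriv_le_of_sub_le {f G : ℝ → ℝ} {f' G' ε : ℝ} (hε : 0 < ε) (hf : HasDerivAt f f' 0)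
    (hG : HasDerivAt G G' 0) (h : ∀ h ∈ Ioo 0 ε, f h - f 0 ≤ G h - G 0) : f' ≤ G' := by
  have h1 := (hasDerivAt_iff_tendsto_slope_zero.1 hf).mono_left
    (nhdsWithin_mono 0 fun x (hx : x ∈ Ioi (0 : ℝ)) => ne_of_gt hx)
  have h2 := (hasDerivAt_iff_tendsto_slope_zero.1 hG).mono_left
    (nhdsWithin_mono 0 fun x (hx : x ∈ Ioi (0 : ℝ)) => ne_of_gt hx)
  refine le_of_tendsto_of_tendsto h1 h2 ?_
  filter_upwards [Ioo_mem_nhdsGT hε] with t ht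
  simp only [zero_add, smul_eq_mul]
  exact mul_le_mul_of_nonneg_left (h t ht) (inv_nonneg.2 ht.1.le)

/-- An integrable function on an interval with nonnegative integrals against nonnegative test
functions is nonnegative. -/
lemma ae_nonneg_of_integral_testFunction {τ : ℝ} {J : ℝ → ℝ} (hJ : IntegrableOn J (Ioo 0 τ))
    (h : ∀ η, IsTestFunction (Ioo 0 τ) η → (∀ t, 0 ≤ η t) → 0 ≤ ∫ t in Ioo 0 τ, J t * η t) :
    ∀ᵐ t ∂(volume.restrict (Ioo 0 τ)), 0 ≤ J t := by
  obtain ⟨r, hr0, -, hr2⟩ := exists_shrinking_bump ℝ one_pos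
  have hI : Integrable ((Ioo 0 τ).indicator J) := hJ.integrable_indicator measurableSet_Ioo
  rw [ae_restrict_iff' measurableSet_Ioo]
  filter_upwards [ae_tendsto_mollify hr0 hr2 hI.locallyIntegrable] with t ht hts
  rw [indicator_of_mem hts] at ht
  refine ge_of_tendsto ht ?_
  obtain ⟨ε, hε, hball⟩ := nhds_basis_closedBall.mem_iff.1 (isOpen_Ioo.mem_nhds hts)
  filter_upwards [hr0.eventually (ge_mem_nhds hε)] with n hn
  rw [mollify_apply]
  have h1 := h (fun s => (r n).normed volume (t - s)) (isTestFunction_bump (r n)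
    ((closedBall_subset_closedBall hn).trans hball))
    fun s => (r n).nonneg_normed _
  rw [← integral_indicator measurableSet_Ioo] at h1
  refine h1.trans_eq (integral_congr_ae (.of_forall fun s => ?_))
  by_cases hs : s ∈ Ioo 0 τ <;> simp [hs, mul_comm]

/-- A one-sided bound on time increments bounds the weak time derivative: by mollification, the
difference quotients of `u` control the mollified derivative. -/
lemma ae_time_deriv_le (hΩ : IsOpen Ω) {τ θ K : ℝ} (hθ : 0 < θ) (hK : 0 ≤ K)
    {u ut : EuclideanSpace ℝ (Fin N) × ℝ → ℝ} (hu : IntegrableOn u (cylinder Ω τ))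
    (hut : IntegrableOn ut (cylinder Ω τ)) (hw : HasWeakDeriv (cylinder Ω τ) u ut (0, 1))
    (hgrow : ∀ x ∈ Ω, ∀ t h : ℝ, 0 < t → 0 < h → t + h < τ →
      u (x, t + h) - u (x, t) ≤ ((1 + h / t) ^ θ - 1) * K) :
    ∀ᵐ z ∂(volume.restrict (cylinder Ω τ)), ut z ≤ θ / z.2 * K := by
  have hU := isOpen_cylinder hΩ τ
  obtain ⟨r, hr0, -, hr2⟩ := exists_shrinking_bump (EuclideanSpace ℝ (Fin N) × ℝ) one_pos
  have hI : Integrable ((cylinder Ω τ).indicator u) := hu.integrable_indicator hU.measurableSet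
  have hIt : Integrable ((cylinder Ω τ).indicator ut) := hut.integrable_indicator hU.measurableSet
  rw [ae_restrict_iff' hU.measurableSet]
  filter_upwards [ae_tendsto_mollify hr0 hr2 hIt.locallyIntegrable] with z hz hzU
  rw [indicator_of_mem hzU] at hz
  obtain ⟨ε, hε, hball⟩ := nhds_basis_closedBall.mem_iff.1 (hU.mem_nhds hzU)
  have hz2 : 0 < z.2 := hzU.2.1
  have hlim : Tendsto (fun n => θ / (z.2 - (r n).rOut) * K) atTop (𝓝 (θ / z.2 * K)) := by
    have h1 : Tendsto (fun n => z.2 - (r n).rOut) atTop (𝓝 z.2) := by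
      simpa using tendsto_const_nhds.sub hr0
    exact (tendsto_const_nhds.div h1 hz2.ne').mul_const K
  refine le_of_tendsto_of_tendsto hz hlim ?_
  filter_upwards [hr0.eventually (ge_mem_nhds (half_pos hε)),
    hr0.eventually (gt_mem_nhds hz2)] with n hn hnz
  have hnε : (r n).rOut ≤ ε := hn.trans (by linarith)
  rw [← fderiv_mollify_eq hU hu hw (r n) ((closedBall_subset_closedBall hnε).trans hball)]
  -- no time seen by the mollification at `z` is earlier than `a`
  obtain ⟨a, ha⟩ : ∃ a, a = z.2 - (r n).rOut := ⟨_, rfl⟩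
  have ha0 : 0 < a := by linarith
  rw [← ha]
  have hder : HasDerivAt (fun h : ℝ => mollify (r n) ((cylinder Ω τ).indicator u) (z + h • (0, 1)))
      (fderiv ℝ (mollify (r n) ((cylinder Ω τ).indicator u)) z (0, 1)) 0 :=
    (((contDiff_mollify (r n) hI.locallyIntegrable).differentiable
      one_ne_zero).differentiableAt.hasFDerivAt.hasLineDerivAt (0, 1))
  have hG : HasDerivAt (fun h : ℝ => ((1 + h / a) ^ θ - 1) * K) (θ / a * K) 0 := by
    have h1 : HasDerivAt (fun h : ℝ => 1 + h / a) (1 / a) 0 :=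
      ((hasDerivAt_id (0 : ℝ)).div_const a).const_add 1
    have h2 := ((h1.rpow_const (p := θ) (Or.inl (by simp))).sub_const 1).mul_const K
    have e : 1 / a * θ * (1 + 0 / a) ^ (θ - 1) * K = θ / a * K := by
      rw [zero_div, add_zero, Real.one_rpow]
      ring
    exact e ▸ h2
  refine deriv_le_of_sub_le (half_pos hε) hder hG fun h hh => ?_
  simp only [zero_smul, add_zero, zero_div, Real.one_rpow, sub_self, zero_mul, sub_zero]
  refine mollify_sub_le (r n) hI.locallyIntegrable fun y hy => ?_
  rw [mem_ball_zero_iff] at hy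
  have hy2 : |y.2| ≤ ‖y‖ := norm_snd_le y
  have hmem1 : z - y ∈ cylinder Ω τ := by
    refine hball ?_
    rw [mem_closedBall, dist_eq_norm, sub_sub_cancel_left, norm_neg]
    linarith
  have hmem2 : z + h • ((0 : EuclideanSpace ℝ (Fin N)), (1 : ℝ)) - y ∈ cylinder Ω τ := by
    refine hball ?_
    rw [mem_closedBall, dist_eq_norm]
    have e : z + h • ((0 : EuclideanSpace ℝ (Fin N)), (1 : ℝ)) - y - z = h • (0, 1) - y := by abel
    rw [e]
    have e2 : ‖h • ((0 : EuclideanSpace ℝ (Fin N)), (1 : ℝ))‖ = h := by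
      rw [norm_smul, Prod.norm_mk, norm_zero, norm_one, Real.norm_of_nonneg hh.1.le]
      simp
    have := norm_sub_le (h • ((0 : EuclideanSpace ℝ (Fin N)), (1 : ℝ))) y
    rw [e2] at this
    linarith [hh.2]
  rw [indicator_of_mem hmem1, indicator_of_mem hmem2]
  have e1 : z - y = (z.1 - y.1, z.2 - y.2) := rfl
  have e2 : z + h • ((0 : EuclideanSpace ℝ (Fin N)), (1 : ℝ)) - y = (z.1 - y.1, z.2 - y.2 + h) := by
    ext1
    · simp
    · simp; ring
  rw [e1] at hmem1 ⊢
  rw [e2] at hmem2 ⊢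
  have hat : a ≤ z.2 - y.2 := by
    have := (abs_le.1 hy2).2
    linarith
  refine (hgrow _ hmem1.1 _ h hmem1.2.1 hh.1 hmem2.2.2).trans ?_
  refine mul_le_mul_of_nonneg_right (sub_le_sub_right ?_ 1) hK
  have h1 : h / (z.2 - y.2) ≤ h / a := div_le_div_of_nonneg_left hh.1.le ha0 hat
  have h2 : 0 ≤ h / (z.2 - y.2) := div_nonneg hh.1.le (ha0.trans_le hat).le
  exact Real.rpow_le_rpow (by linarith) (by linarith) hθ.le

/-- The essential supremum of a continuous function bounds it on the closure of the domain. -/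
lemma le_supNorm (hΩ : IsOpen Ω) {f : EuclideanSpace ℝ (Fin N) → ℝ}
    (hf : MemLp f ∞ (volume.restrict Ω)) (hc : ContinuousOn f (closure Ω)) :
    ∀ x ∈ closure Ω, f x ≤ supNorm Ω f := by
  have hae : ∀ᵐ x ∂(volume.restrict Ω), f x ≤ supNorm Ω f := by
    have hfin := hf.2
    rw [supNorm]
    rw [eLpNorm_exponent_top] at hfin ⊢
    filter_upwards [ae_le_eLpNormEssSup (f := f) (μ := volume.restrict Ω)] with x hx
    have := ENNReal.toReal_mono hfin.ne hx
    exact (le_abs_self _).trans (by simpa using this)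
  have hmax : ContinuousOn (fun x => max (f x) (supNorm Ω f)) (closure Ω) :=
    ContinuousOn.sup hc continuousOn_const
  have h1 : EqOn (fun x => max (f x) (supNorm Ω f)) (fun _ => supNorm Ω f) Ω := by
    refine Measure.eqOn_open_of_ae_eq (μ := volume) ?_ hΩ (hmax.mono subset_closure)
      continuousOn_const
    filter_upwards [hae] with x hx using max_eq_right hx
  have h2 := h1.of_subset_closure hmax continuousOn_const subset_closure subset_rfl
  exact fun x hx => max_eq_right_iff.1 (h2 hx)

/-- Solutions with nonnegative data are nonnegative, and the comparison of `u` with its rescaled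
copies bounds its growth in time. -/
lemma growth_of_isWeakSolution (hΩ : IsOpen Ω) (hb : Bornology.IsBounded Ω) {p q S K : ℝ}
    (hp : 2 < p) (hq : p - 1 < q) {g u₀ : EuclideanSpace ℝ (Fin N) → ℝ}
    (hg : ∀ x ∈ frontier Ω, 0 ≤ g x) (hu₀ : ∀ x ∈ Ω, 0 ≤ u₀ x)
    (hgK : ∀ x ∈ frontier Ω, g x ≤ K) (hu₀K : ∀ x ∈ Ω, u₀ x ≤ K)
    {u ut : EuclideanSpace ℝ (Fin N) × ℝ → ℝ}
    {Du : EuclideanSpace ℝ (Fin N) × ℝ → EuclideanSpace ℝ (Fin N)}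
    (huL : ∀ s ∈ Ioo 0 S, MemLpW1 Ω s ∞ u Du)
    (hu : ∀ s ∈ Ioo 0 S, IsWeakSolution Ω p q g u₀ s u Du ut) :
    ∀ x ∈ Ω, ∀ t h : ℝ, 0 < t → 0 < h → t + h < S →
      u (x, t + h) - u (x, t) ≤ ((1 + h / t) ^ (1 / (p - 2)) - 1) * K := by
  intro x hx t h ht hh hth
  have hp2 : 0 < p - 2 := by linarith
  have hnonneg : 0 ≤ u (x, t + h) :=
    comparison_principle hΩ hb hp.le (by linarith) (v := fun _ => 0) (vt := fun _ => 0)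
      (Dv := fun _ => 0)
      (fun s _ => ⟨MemLp.zero', MemLp.zero',
        (isWeakSubsolution_zero (p := p) (q := q) (s := s) (by linarith) hu₀ hg).1.2.1.2.2⟩)
      huL (fun s _ => isWeakSubsolution_zero (by linarith) hu₀ hg) (fun s hs => (hu s hs).1)
      x hx (t + h) ⟨by linarith, hth⟩
  -- the dilation by `κ` maps the time `t` to `t + h`
  obtain ⟨κ, hκ⟩ : ∃ κ, κ = 1 + h / t := ⟨_, rfl⟩
  have hκ1 : 1 ≤ κ := by rw [hκ]; linarith [div_nonneg hh.le ht.le]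
  have hκ0 : 0 < κ := by linarith
  obtain ⟨l, hl⟩ : ∃ l, l = κ ^ (1 / (p - 2)) := ⟨_, rfl⟩
  have hl1 : 1 ≤ l := hl ▸ Real.one_le_rpow hκ1 (by positivity)
  have hlκ : l ^ (p - 2) = κ := by
    rw [hl, ← Real.rpow_mul hκ0.le, one_div, inv_mul_cancel₀ hp2.ne', Real.rpow_one]
  have hκt : κ * t = t + h := by rw [hκ]; field_simp
  have hscale : ∀ s ∈ Ioo 0 (S / κ), κ * s ∈ Ioo 0 S := fun s hs =>
    ⟨mul_pos hκ0 hs.1, by rw [mul_comm]; exact (lt_div_iff₀ hκ0).1 hs.2⟩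
  have hSκ : ∀ s ∈ Ioo 0 (S / κ), s ∈ Ioo 0 S := fun s hs =>
    ⟨hs.1, (le_mul_of_one_le_left hs.1.le hκ1).trans_lt (hscale s hs).2⟩
  have hdata : ∀ y ≤ K, l * y - (l - 1) * K ≤ y := fun y hy => by nlinarith
  have hcomp := comparison_principle hΩ hb hp.le (by linarith) (S := S / κ)
    (v := fun z => l * u (timeDilation κ z) - (l - 1) * K)
    (fun s hs => ((huL _ (hscale s hs)).comp_timeDilation hκ0).affine hb le_top l _)
    (fun s hs => huL s (hSκ s hs))
    (fun s hs => by
      have := IsWeakSubsolution.rescale hΩ hb hp.le hq.le hs.1 hl1 (c := (l - 1) * K)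
        (hlκ ▸ (hu _ (hscale s hs)).2) (fun x hx => hdata _ (hu₀K x hx))
        (fun x hx => hdata _ (hgK x hx))
      rwa [hlκ] at this)
    (fun s hs => (hu s (hSκ s hs)).1) x hx t ⟨ht, by rw [lt_div_iff₀ hκ0, mul_comm, hκt]; exact hth⟩
  simp only [timeDilation, hκt] at hcomp
  rw [← hκ, ← hl]
  nlinarith

/-- A one-sided distributional bound on a divergence need only be tested on countably many
functions, because the space of continuously differentiable functions on a compact set is
separable. -/
lemma exists_countable_testFunctions (hΩ : IsOpen Ω) (hb : Bornology.IsBounded Ω) :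
    ∃ D : Set (EuclideanSpace ℝ (Fin N) → ℝ), D.Countable ∧
      (∀ φ ∈ D, IsTestFunction Ω φ ∧ ∀ x, 0 ≤ φ x) ∧
      ∀ (F : EuclideanSpace ℝ (Fin N) → EuclideanSpace ℝ (Fin N)) (c : ℝ), IntegrableOn F Ω →
        (∀ φ ∈ D, -∫ x in Ω, fderiv ℝ φ x (F x) ≤ ∫ x in Ω, c * φ x) →
        ∀ φ, IsTestFunction Ω φ → (∀ x, 0 ≤ φ x) →
          -∫ x in Ω, fderiv ℝ φ x (F x) ≤ ∫ x in Ω, c * φ x := by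
  have hfin := isFiniteMeasure_restrict hb
  have : CompactSpace (closure Ω) := isCompact_iff_compactSpace.1 hb.isCompact_closure
  have : SecondCountableTopology (EuclideanSpace ℝ (Fin N) →L[ℝ] ℝ) :=
    have := FiniteDimensional.proper ℝ (EuclideanSpace ℝ (Fin N) →L[ℝ] ℝ)
    inferInstance
  -- test functions are compared with their derivatives, uniformly on the closure of `Ω`
  let T : Set (EuclideanSpace ℝ (Fin N) → ℝ) := {φ | IsTestFunction Ω φ ∧ ∀ x, 0 ≤ φ x}
  let J : T → C(closure Ω, ℝ × (EuclideanSpace ℝ (Fin N) →L[ℝ] ℝ)) := fun φ =>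
    ⟨fun x => (φ.1 x, fderiv ℝ φ.1 x), (φ.2.1.continuous.prodMk
      (φ.2.1.1.continuous_fderiv (by simp))).comp continuous_subtype_val⟩
  obtain ⟨t, htJ, htc, hdense⟩ :=
    (TopologicalSpace.IsSeparable.of_separableSpace (range J)).exists_countable_dense_subset
  choose ψ hψ using fun f : t => htJ f.2
  have := htc.to_subtype
  refine ⟨range fun f => (ψ f : EuclideanSpace ℝ (Fin N) → ℝ), countable_range _, ?_, ?_⟩
  · rintro _ ⟨f, rfl⟩
    exact (ψ f).2
  intro F c hF hD φ hφ hφ0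
  have hi : ∀ φ, IsTestFunction Ω φ → IntegrableOn (fun x => fderiv ℝ φ x (F x)) Ω := by
    intro φ hφ
    obtain ⟨C, hC⟩ := (hφ.2.1.fderiv (𝕜 := ℝ)).exists_bound_of_continuous
      (hφ.1.continuous_fderiv (by simp))
    refine (hF.norm.const_mul C).mono' ?_ (.of_forall fun x => (fderiv ℝ φ x).le_of_opNorm_le
      (hC x) (F x))
    exact (ContinuousLinearMap.apply ℝ ℝ).flip.aestronglyMeasurable_comp₂
      (hφ.1.continuous_fderiv (by simp)).aestronglyMeasurable hF.aestronglyMeasurable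
  have hi' : ∀ φ, IsTestFunction Ω φ → IntegrableOn (fun x => c * φ x) Ω := fun φ hφ =>
    ((hφ.continuous.integrable_of_hasCompactSupport hφ.2.1).const_mul c).integrableOn
  have hA : 0 ≤ ∫ x in Ω, (‖F x‖ + |c|) := integral_nonneg fun x => by positivity
  refine le_of_forall_pos_le_add fun ε hε => ?_
  obtain ⟨δ, hδ, hδε⟩ : ∃ δ > 0, δ * ∫ x in Ω, (‖F x‖ + |c|) ≤ ε := by
    refine ⟨ε / ((∫ x in Ω, (‖F x‖ + |c|)) + 1), by positivity, ?_⟩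
    rw [div_mul_eq_mul_div, div_le_iff₀ (by positivity)]
    nlinarith
  have hcl : J ⟨φ, hφ, hφ0⟩ ∈ closure t := hdense (mem_range_self _)
  obtain ⟨f, hft, hfd⟩ := (Metric.mem_closure_iff
    (α := C(closure Ω, ℝ × (EuclideanSpace ℝ (Fin N) →L[ℝ] ℝ)))).1 hcl δ hδ
  lift f to t using hft
  have hψt := (ψ f).2.1
  have hclose : ∀ x ∈ Ω, |φ x - (ψ f).1 x| ≤ δ ∧ ‖fderiv ℝ φ x - fderiv ℝ (ψ f).1 x‖ ≤ δ := by
    intro x hx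
    rw [← hψ f] at hfd
    have h1 := (ContinuousMap.dist_apply_le_dist (f := J ⟨φ, hφ, hφ0⟩) (g := J (ψ f))
      (⟨x, subset_closure hx⟩ : closure Ω)).trans hfd.le
    rw [dist_eq_norm, Prod.norm_def, max_le_iff] at h1
    exact h1
  have hDf := hD _ ⟨f, rfl⟩
  have key : (∫ x in Ω, ((c * (ψ f).1 x + fderiv ℝ (ψ f).1 x (F x)) -
      (c * φ x + fderiv ℝ φ x (F x)))) ≤ ∫ x in Ω, δ * (‖F x‖ + |c|) := by
    refine integral_mono_ae (((hi' _ hψt).add (hi _ hψt)).sub ((hi' _ hφ).add (hi _ hφ)))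
      ((hF.norm.add (integrable_const _)).const_mul δ)
      (ae_restrict_of_forall_mem hΩ.measurableSet fun x hx => ?_)
    obtain ⟨h1, h2⟩ := hclose x hx
    have h3 : |c * ((ψ f).1 x - φ x)| ≤ |c| * δ := by
      rw [abs_mul, abs_sub_comm]
      exact mul_le_mul_of_nonneg_left h1 (abs_nonneg c)
    have h4 : |(fderiv ℝ φ x - fderiv ℝ (ψ f).1 x) (F x)| ≤ δ * ‖F x‖ :=
      ContinuousLinearMap.le_of_opNorm_le _ h2 (F x)
    rw [_root_.sub_apply] at h4
    have h5 := (abs_le.1 h4).1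
    have h6 := (abs_le.1 h3).2
    simp only
    linarith
  have hsplit := integral_sub ((hi' _ hψt).add (hi _ hψt)) ((hi' _ hφ).add (hi _ hφ))
  simp only [Pi.add_apply] at hsplit
  rw [hsplit, integral_add (hi' _ hψt) (hi _ hψt), integral_add (hi' _ hφ) (hi _ hφ),
    integral_const_mul δ] at key
  linarith

/-! ### The bound on the divergence of the flux -/

/-- It suffices to exclude null sets of times on the intervals `(0, τ)` with rational `τ < T`. -/
lemma ae_of_forall_ae_Ioo {T : EReal} {P : ℝ → Prop}
    (h : ∀ τ : ℝ, 0 < τ → (τ : EReal) < T → ∀ᵐ t ∂(volume.restrict (Ioo 0 τ)), P t) :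
    ∀ᵐ t : ℝ, 0 < t → (t : EReal) < T → P t := by
  have h1 : ∀ r : ℚ, ∀ᵐ t : ℝ, 0 < (r : ℝ) → ((r : ℝ) : EReal) < T → t ∈ Ioo 0 (r : ℝ) → P t := by
    intro r
    by_cases hr : 0 < (r : ℝ) ∧ ((r : ℝ) : EReal) < T
    · have := h r hr.1 hr.2
      rw [ae_restrict_iff' measurableSet_Ioo] at this
      filter_upwards [this] with t ht _ _ hts using ht hts
    · exact .of_forall fun t h0 hT => (hr ⟨h0, hT⟩).elim
  filter_upwards [ae_all_iff.2 h1] with t ht h0 hT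
  obtain ⟨r, hr1, hr2⟩ := EReal.lt_iff_exists_rat_btwn.1 hT
  have htr : t < (r : ℝ) := by exact_mod_cast hr1
  exact ht r (h0.trans htr) hr2 ⟨h0, htr⟩

/-- Products of nonnegative test functions in space and time are admissible. -/
lemma isAdmissible_mul (hΩ : IsOpen Ω) (hb : Bornology.IsBounded Ω) {p s : ℝ}
    {φ : EuclideanSpace ℝ (Fin N) → ℝ} {η : ℝ → ℝ} (hφ : IsTestFunction Ω φ)
    (hφ0 : ∀ x, 0 ≤ φ x) (hη : IsTestFunction (Ioo 0 s) η) (hη0 : ∀ t, 0 ≤ η t) :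
    IsAdmissible Ω p s (fun z => φ z.1 * η z.2) (fun z => η z.2 • gradient φ z.1) := by
  have hfin := isFiniteMeasure_restrict_cylinder hb s
  have hc : Continuous fun z : EuclideanSpace ℝ (Fin N) × ℝ => φ z.1 * η z.2 :=
    (hφ.continuous.comp continuous_fst).mul (hη.continuous.comp continuous_snd)
  have hgc : Continuous (gradient φ) :=
    (InnerProductSpace.toDual ℝ _).symm.continuous.comp (hφ.1.continuous_fderiv (by simp))
  have hDc : Continuous fun z : EuclideanSpace ℝ (Fin N) × ℝ => η z.2 • gradient φ z.1 :=
    (hη.continuous.comp continuous_snd).smul (hgc.comp continuous_fst)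
  have hbound : ∀ {F : Type} [NormedAddCommGroup F]
      {f : EuclideanSpace ℝ (Fin N) × ℝ → F}, Continuous f →
      ∃ C, ∀ᵐ z ∂(volume.restrict (cylinder Ω s)), ‖f z‖ ≤ C := by
    intro F _ f hf
    obtain ⟨C, hC⟩ := (hb.isCompact_closure.prod
      (isCompact_Icc (a := 0) (b := s))).exists_bound_of_continuousOn hf.continuousOn
    exact ⟨C, ae_restrict_of_forall_mem (isOpen_cylinder hΩ s).measurableSet fun z hz =>
      hC z (prod_mono subset_closure Ioo_subset_Icc_self hz)⟩
  obtain ⟨C₁, hC₁⟩ := hbound hc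
  obtain ⟨C₂, hC₂⟩ := hbound hDc
  refine ⟨hc.continuousOn, ⟨MemLp.of_bound hc.aestronglyMeasurable C₁ hC₁,
    MemLp.of_bound hDc.aestronglyMeasurable C₂ hC₂, .of_forall fun t => ⟨?_, ?_, ?_⟩⟩,
    fun z _ => mul_nonneg (hφ0 _) (hη0 _), ?_⟩
  · have : Continuous fun x => φ x * η t := hφ.continuous.mul continuous_const
    exact this.locallyIntegrable.locallyIntegrableOn _
  · have : Continuous fun x => η t • gradient φ x := hgc.const_smul (η t)
    exact this.locallyIntegrable.locallyIntegrableOn _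
  · intro ξ hξ v
    have h1 : ContDiff ℝ 1 fun x => φ x * η t := (hφ.1.of_le (by simp)).mul contDiff_const
    rw [ContDiff.hasWeakDeriv h1 v ξ hξ]
    congr 1
    refine integral_congr_ae (.of_forall fun x => ?_)
    have h2 : HasFDerivAt (fun x => φ x * η t) (η t • fderiv ℝ φ x) x :=
      (hφ.1.differentiable (by simp)).differentiableAt.hasFDerivAt.mul_const (η t)
    simp [h2.fderiv, inner_smul_left, gradient]
  · intro x hx t _
    have : x ∉ Ω := fun h => by
      rw [hΩ.frontier_eq] at hx
      exact hx.2 h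
    simp [hφ.eq_zero this]

/-- A bound on the time derivative of a solution is inherited by the divergence of its flux, since
the source term is nonnegative. -/
lemma ae_neg_integral_flux_le (hΩ : IsOpen Ω) (hb : Bornology.IsBounded Ω) {p q τ : ℝ}
    (hp : 2 ≤ p) {g u₀ : EuclideanSpace ℝ (Fin N) → ℝ} {u ut : EuclideanSpace ℝ (Fin N) × ℝ → ℝ}
    {Du : EuclideanSpace ℝ (Fin N) × ℝ → EuclideanSpace ℝ (Fin N)}
    (huL : MemLpW1 Ω τ ∞ u Du) (hu : IsWeakSupersolution Ω p q g u₀ τ u Du ut)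
    {φ : EuclideanSpace ℝ (Fin N) → ℝ} (hφ : IsTestFunction Ω φ) (hφ0 : ∀ x, 0 ≤ φ x) :
    ∀ᵐ t ∂(volume.restrict (Ioo 0 τ)),
      -∫ x in Ω, fderiv ℝ φ x (‖Du (x, t)‖ ^ (p - 2) • Du (x, t)) ≤
        ∫ x in Ω, ut (x, t) * φ x := by
  have hfin := isFiniteMeasure_restrict_cylinder hb τ
  have hut : IntegrableOn ut (cylinder Ω τ) := hu.1.2.2.1.integrable one_le_two
  obtain ⟨M, hM⟩ := huL.exists_bound
  have hDm := huL.2.1.aestronglyMeasurable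
  obtain ⟨C, hC⟩ := hφ.2.1.exists_bound_of_continuous hφ.continuous
  have hgc : Continuous (gradient φ) :=
    (InnerProductSpace.toDual ℝ _).symm.continuous.comp (hφ.1.continuous_fderiv (by simp))
  have hgs : HasCompactSupport (gradient φ) := by
    refine (hφ.2.1.fderiv (𝕜 := ℝ)).mono fun x hx h0 => hx ?_
    simp only [gradient, h0, map_zero]
  obtain ⟨C', hC'⟩ := hgs.exists_bound_of_continuous hgc
  have hi1 : IntegrableOn (fun z => ut z * φ z.1) (cylinder Ω τ) :=
    hut.mul_bdd (c := C) (hφ.continuous.comp continuous_fst).aestronglyMeasurable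
      (.of_forall fun z => hC z.1)
  have hi2 : IntegrableOn (fun z => ‖Du z‖ ^ (p - 2) * inner ℝ (Du z) (gradient φ z.1))
      (cylinder Ω τ) := by
    refine Integrable.of_bound ((hDm.norm.aemeasurable.pow_const _).aestronglyMeasurable.mul
      (hDm.inner (hgc.comp continuous_fst).aestronglyMeasurable)) (M ^ (p - 2) * (M * C')) ?_
    filter_upwards [hM] with z hz
    exact norm_pow_mul_inner_le (by linarith) hz (hC' z.1)
  have hi : IntegrableOn (fun z => ut z * φ z.1 +
      ‖Du z‖ ^ (p - 2) * inner ℝ (Du z) (gradient φ z.1)) (cylinder Ω τ) := hi1.add hi2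
  -- `ut` is kept in the integrand: the bound `c / t` is not integrable near `t = 0`
  have hJ := ae_nonneg_of_integral_testFunction (integrableOn_integral_slice hi) fun η hη hη0 => by
    have h1 := hu.2.2.2 _ _ (isAdmissible_mul (p := p) hΩ hb hφ hφ0 hη hη0)
    have h0 : 0 ≤ ∫ z in cylinder Ω τ, ‖Du z‖ ^ q * (φ z.1 * η z.2) :=
      integral_nonneg fun z => mul_nonneg (by positivity) (mul_nonneg (hφ0 _) (hη0 _))
    have h2 := h0.trans h1
    obtain ⟨B, hB⟩ := hη.2.1.exists_bound_of_continuous hη.continuous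
    have hηc : Continuous fun z : EuclideanSpace ℝ (Fin N) × ℝ => η z.2 :=
      hη.continuous.comp continuous_snd
    have hiη : IntegrableOn (fun z => (ut z * φ z.1 +
        ‖Du z‖ ^ (p - 2) * inner ℝ (Du z) (gradient φ z.1)) * η z.2) (cylinder Ω τ) :=
      hi.mul_bdd (c := B) hηc.aestronglyMeasurable (.of_forall fun z => hB z.2)
    have h3 := integral_cylinder hiη
    simp only [integral_mul_const] at h3
    rw [← h3]
    refine h2.trans_eq (integral_congr_ae (.of_forall fun z => ?_))
    simp only [inner_smul_right]
    ring
  have hs1 : ∀ᵐ t ∂(volume.restrict (Ioo 0 τ)), IntegrableOn (fun x => ut (x, t) * φ x) Ω := by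
    rw [IntegrableOn, restrict_cylinder] at hi1
    exact hi1.prod_left_ae
  have hs2 : ∀ᵐ t ∂(volume.restrict (Ioo 0 τ)), IntegrableOn (fun x =>
      ‖Du (x, t)‖ ^ (p - 2) * inner ℝ (Du (x, t)) (gradient φ x)) Ω := by
    rw [IntegrableOn, restrict_cylinder] at hi2
    exact hi2.prod_left_ae
  filter_upwards [hJ, hs1, hs2] with t ht h1 h2
  rw [integral_add h1 h2] at ht
  have e : ∫ x in Ω, fderiv ℝ φ x (‖Du (x, t)‖ ^ (p - 2) • Du (x, t)) =
      ∫ x in Ω, ‖Du (x, t)‖ ^ (p - 2) * inner ℝ (Du (x, t)) (gradient φ x) := by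
    refine integral_congr_ae (.of_forall fun x => ?_)
    simp only [map_smul, smul_eq_mul]
    rw [real_inner_comm, gradient, InnerProductSpace.toDual_symm_apply]
  rw [e]
  linarith

end DegenerateHJ

open DegenerateHJ in
theorem theorem1p3 {N : ℕ} (Ω : Set (EuclideanSpace ℝ (Fin N)))
    (hΩ_open : IsOpen Ω) (hΩ_conn : IsConnected Ω) (hΩ_bdd : Bornology.IsBounded Ω)
    (hΩ_reg : DegenerateHJ.HasC2HolderBoundary Ω)
    (p q : ℝ) (hp : 1 < p - 1) (hq : p - 1 < q)
    (g u₀ : EuclideanSpace ℝ (Fin N) → ℝ)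
    (hg : ContDiffOn ℝ 2 g (closure Ω)) (hg_nonneg : ∀ x ∈ frontier Ω, 0 ≤ g x)
    (hu₀ : DegenerateHJ.MemW1 Ω ∞ u₀) (hu₀_cont : ContinuousOn u₀ (closure Ω))
    (hu₀_nonneg : ∀ x ∈ Ω, 0 ≤ u₀ x) (hu₀_bdry : ∀ x ∈ frontier Ω, u₀ x = g x)
    -- `T` is the (possibly infinite) existence time; `T = T_max(u₀)` is included
    (T : EReal)
    (u : EuclideanSpace ℝ (Fin N) × ℝ → ℝ)
    (Du : EuclideanSpace ℝ (Fin N) × ℝ → EuclideanSpace ℝ (Fin N))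
    (ut : EuclideanSpace ℝ (Fin N) × ℝ → ℝ)
    (hu : ∀ τ : ℝ, 0 < τ → (τ : EReal) < T →
      DegenerateHJ.IsWeakSolution Ω p q g u₀ τ u Du ut)
    -- `u ∈ L^∞_loc([0,T); W^{1,∞}(Ω))`
    (hu_lip : ∀ τ : ℝ, 0 < τ → (τ : EReal) < T → DegenerateHJ.MemLpW1 Ω τ ∞ u Du) :
    (∀ᵐ t : ℝ, 0 < t → (t : EReal) < T →
      DegenerateHJ.DistribLE Ω (fun x => ut (x, t))
        (1 / (p - 2) * (DegenerateHJ.supNorm Ω u₀ / t))) ∧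
    (∀ᵐ t : ℝ, 0 < t → (t : EReal) < T →
      DegenerateHJ.DistribDivLE Ω (fun x => ‖Du (x, t)‖ ^ (p - 2) • Du (x, t))
        (1 / (p - 2) * (DegenerateHJ.supNorm Ω u₀ / t))) := by
  have hp2 : 2 < p := by linarith
  obtain ⟨_, _, hu₀m, _⟩ := hu₀
  have hK := le_supNorm hΩ_open hu₀m hu₀_cont
  have hgK : ∀ x ∈ frontier Ω, g x ≤ supNorm Ω u₀ := fun x hx =>
    hu₀_bdry x hx ▸ hK x (frontier_subset_closure hx)
  -- the pointwise bound on the time derivative, slice by slice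
  have hslice : ∀ τ : ℝ, 0 < τ → (τ : EReal) < T → ∀ᵐ t ∂(volume.restrict (Ioo 0 τ)),
      IntegrableOn (fun x => ut (x, t)) Ω ∧ ∀ᵐ x ∂(volume.restrict Ω),
        ut (x, t) ≤ 1 / (p - 2) * (supNorm Ω u₀ / t) := by
    intro τ hτ hτT
    have hfin := isFiniteMeasure_restrict_cylinder hΩ_bdd τ
    have hbefore : ∀ s ∈ Ioo 0 τ, (s : EReal) < T := fun s hs =>
      (EReal.coe_lt_coe_iff.2 hs.2).trans hτT
    have hgrow := growth_of_isWeakSolution hΩ_open hΩ_bdd hp2 hq hg_nonneg hu₀_nonneg hgK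
      (fun x hx => hK x (subset_closure hx)) (fun s hs => hu_lip s hs.1 (hbefore s hs))
      (fun s hs => hu s hs.1 (hbefore s hs))
    have hτu := (hu τ hτ hτT).1.1
    have hut : IntegrableOn ut (cylinder Ω τ) := hτu.2.2.1.integrable one_le_two
    have hbound := ae_slice (ae_time_deriv_le hΩ_open (by
      have : 0 < p - 2 := by linarith
      positivity) ENNReal.toReal_nonneg ((hu_lip τ hτ hτT).1.integrable le_top) hut
      hτu.2.2.2 hgrow)
    have hut' := hut
    rw [IntegrableOn, restrict_cylinder] at hut'
    filter_upwards [hbound, hut'.prod_left_ae] with t ht hti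
    refine ⟨hti, ht.mono fun x hx => hx.trans_eq ?_⟩
    simp only [supNorm]
    ring
  have hint : ∀ {t c : ℝ}, IntegrableOn (fun x => ut (x, t)) Ω →
      (∀ᵐ x ∂(volume.restrict Ω), ut (x, t) ≤ c) →
      ∀ φ : EuclideanSpace ℝ (Fin N) → ℝ, IsTestFunction Ω φ → (∀ x, 0 ≤ φ x) →
        ∫ x in Ω, ut (x, t) * φ x ≤ ∫ x in Ω, c * φ x := by
    intro t c hti ht φ hφ hφ0
    obtain ⟨C, hC⟩ := hφ.2.1.exists_bound_of_continuous hφ.continuous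
    refine integral_mono_ae (hti.mul_bdd (c := C) hφ.continuous.aestronglyMeasurable
      (.of_forall hC)) ((hφ.continuous.integrable_of_hasCompactSupport hφ.2.1).const_mul
      c).integrableOn ?_
    filter_upwards [ht] with x hx using mul_le_mul_of_nonneg_right hx (hφ0 x)
  refine ⟨ae_of_forall_ae_Ioo fun τ hτ hτT => ?_, ae_of_forall_ae_Ioo fun τ hτ hτT => ?_⟩
  · filter_upwards [hslice τ hτ hτT] with t ht
    exact ⟨ht.1.locallyIntegrableOn, hint ht.1 ht.2⟩
  · obtain ⟨D, hD, hDt, hDall⟩ := exists_countable_testFunctions hΩ_open hΩ_bdd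
    have huL := hu_lip τ hτ hτT
    have hflux := (ae_ball_iff hD).2 fun φ hφ => ae_neg_integral_flux_le hΩ_open hΩ_bdd hp2.le huL
      (hu τ hτ hτT).1 (hDt φ hφ).1 (hDt φ hφ).2
    obtain ⟨M, hM⟩ := huL.exists_bound
    have hDm := huL.2.1.aestronglyMeasurable
    have hFi := ae_integrableOn_slice (M := M ^ (p - 2) * M) hΩ_bdd
      (f := fun z => ‖Du z‖ ^ (p - 2) • Du z)
      ((hDm.norm.aemeasurable.pow_const _).aestronglyMeasurable.smul hDm) (by
        filter_upwards [hM] with z hz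
        rw [norm_smul, Real.norm_of_nonneg (by positivity)]
        exact mul_le_mul (Real.rpow_le_rpow (norm_nonneg _) hz (by linarith)) hz (norm_nonneg _)
          (Real.rpow_nonneg ((norm_nonneg _).trans hz) _))
    filter_upwards [hslice τ hτ hτT, hflux, hFi] with t ht htf hti
    exact ⟨hti.locallyIntegrableOn, hDall _ _ hti fun φ hφ =>
      (htf φ hφ).trans (hint ht.1 ht.2 φ (hDt φ hφ).1 (hDt φ hφ).2)⟩
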